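/- Let $\{X_n\}_{n\ge 0}$ be an irreducible (possibly periodic) Markov chain on a finite state space $\Sigma$ with transition matrix $P$ and stationary distribution $\pi$. For $j\in\Sigma$ let $\mathbb P_j,\mathbb E_j$ refer to the chain started at $X_0=j$. Fix $i\in\Sigma$ and put $$T_i=\inf\{n\ge 1: X_n=i\},\qquad H_i=\max_{j\in\Sigma}\mathbb E_j[T_i],\qquad Z=(I-P+\mathbf 1\pi^{T})^{-1},\qquad Z_{\max}(i)=\max_{k\in\Sigma}|Z_{ki}| .$$ Let $\Delta,\varepsilon,\alpha\in(0,1)$ and consider the following algorithm. In iteration $t=1,2,\dots$, with $\theta^{(t)}=2^t$, it draws $N^{(t)}$ fresh independent trajectories of the chain started at $i$, and sets * $\hat T_i^{(t)}$ = the average of $\min(T_i,\theta^{(t)})$ over these $N^{(t)}$ samples, and $\hat\pi_i^{(t)}=1/\hat T_i^{(t)}$; * $\hat p^{(t)}$ = the fraction of these samples that are truncated, i.e. have $T_i>\theta^{(t)}$. Here $$N^{(1)}=\left\lceil \frac{6(1+\varepsilon)\ln(8/\alpha)}{\varepsilon^2}\right\rceil,\qquad N^{(t+1)}=\left\lceil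 \frac{3(1+\varepsilon)\,\theta^{(t+1)}\ln(4\theta^{(t+1)}/\alpha)}{\hat T_i^{(t)}\,\varepsilon^2}\right\rceil .$$ The algorithm stops in iteration $t$ at condition (a) if $\hat\pi_i^{(t)}<\Delta/(1+\varepsilon)$; otherwise it stops in iteration $t$ at condition (b) if $\hat p^{(t)}\hat\pi_i^{(t)}<\varepsilon\Delta$; otherwise it goes on to iteration $t+1$. The quantities $\hat T_i^{(t)},\hat\pi_i^{(t)},\hat p^{(t)},N^{(t)}$ are defined for all $t\ge1$ by continuing the iterations regardless of the stopping conditions. **Theorem.** With probability greater than $1-\alpha$, for all iterations $t\ge 1$, $$\left|\frac{\hat\pi_i^{(t)}-\pi_i}{\hat\pi_i^{(t)}}\right|\;\le\; 2(1-\varepsilon)\,\mathbb P_i\big(T_i>\theta^{(t)}\big)\,Z_{\max}(i)+\varepsilon\;\le\;4(1-\varepsilon)\,2^{-\theta^{(t)}/(2H_i)}\,Z_{\max}(i)+\varepsilon .$$ Moreover, with probability greater than $1-\alpha$, if the algorithm terminates at condition (b), in iteration $t_{\max}$ say, then $$\left|\frac{\hat\pi_i^{(t_{\max})}-\pi_i}{\hat\pi_i^{(t_{\max})}}\right|\;\le\;\varepsilon\,\big(3Z_{\max}(i)+1\big).$$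 -/

import Mathlib

open MeasureTheory ProbabilityTheory
open scoped ENNReal

namespace TruncatedWalk

section Chain

variable {S : Type*} [Fintype S] [DecidableEq S]

/-- `π` is a stationary distribution of the transition matrix `P`. -/
structure IsStationaryDistribution (P : Matrix S S ℝ) (π : S → ℝ) : Prop where
  nonneg : ∀ x, 0 ≤ π x
  sum_eq_one : ∑ x, π x = 1
  stationary : ∀ x, π x = ∑ y, π y * P y x

/-- The fundamental matrix `Z = (I - P + 𝟙 πᵀ)⁻¹`. The matrix that is inverted is invertible for every
irreducible stochastic `P`, periodic or not; for aperiodic `P` the inverse is `∑ₜ (Pᵗ - 𝟙 πᵀ)`. -/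
noncomputable def fundamentalMatrix (P : Matrix S S ℝ) (π : S → ℝ) : Matrix S S ℝ :=
  (1 - P + Matrix.of fun _ y => π y)⁻¹

/-- `Z_max(i) = max_k |Z_{ki}|`. -/
noncomputable def Zmax (P : Matrix S S ℝ) (π : S → ℝ) (i : S) : ℝ :=
  ⨆ k, |fundamentalMatrix P π k i|

variable [MeasurableSpace S] [MeasurableSingletonClass S]

/-- One step of the chain: from `x`, the next state has law `∑ y, P x y δ_y`. -/
noncomputable def stepKernel (P : Matrix S S ℝ) : Kernel S S :=
  Kernel.ofFunOfCountable fun x => ∑ y, ENNReal.ofReal (P x y) • Measure.dirac y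

theorem isMarkovKernel_stepKernel {P : Matrix S S ℝ} (hP : P ∈ Matrix.rowStochastic ℝ S) :
    IsMarkovKernel (stepKernel P) := by
  refine ⟨fun x => ⟨?_⟩⟩
  change (∑ y, ENNReal.ofReal (P x y) • Measure.dirac y : Measure S) Set.univ = 1
  simp only [Measure.coe_finsetSum, Finset.sum_apply, Measure.smul_apply, measure_univ,
    smul_eq_mul, mul_one]
  rw [← ENNReal.ofReal_sum_of_nonneg fun y _ => Matrix.nonneg_of_mem_rowStochastic hP,
    Matrix.sum_row_of_mem_rowStochastic hP, ENNReal.ofReal_one]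

/-- The law of the next state given the states at the times `0, …, n`; it depends on the present
state only. -/
noncomputable def historyKernel (P : Matrix S S ℝ) (n : ℕ) :
    Kernel ((_ : Finset.Iic n) → S) S :=
  (stepKernel P).comap (fun h => h ⟨n, Finset.mem_Iic.2 le_rfl⟩) (measurable_pi_apply _)

theorem isMarkovKernel_historyKernel {P : Matrix S S ℝ} (hP : P ∈ Matrix.rowStochastic ℝ S)
    (n : ℕ) : IsMarkovKernel (historyKernel P n) := by
  have := isMarkovKernel_stepKernel hP
  unfold historyKernel
  infer_instance

/-- `ℙ_i`: the law, on the space of trajectories `ℕ → S`, of the Markov chain with transition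
matrix `P` started at `X₀ = i`. -/
noncomputable def pathLaw (P : Matrix S S ℝ) (hP : P ∈ Matrix.rowStochastic ℝ S) (i : S) :
    Measure (ℕ → S) :=
  haveI := isMarkovKernel_historyKernel hP
  Kernel.traj (X := fun _ => S) (historyKernel P) 0 fun _ => i

end Chain

section ReturnTime

variable {S : Type*}

/-- `T_i = inf {n ≥ 1 : X_n = i}`, the return (or hitting) time of the trajectory `x`. -/
noncomputable def returnTime (i : S) (x : ℕ → S) : ℕ∞ :=
  ⨅ (n : ℕ) (_ : 1 ≤ n ∧ x n = i), (n : ℕ∞)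

variable [Fintype S] [DecidableEq S] [MeasurableSpace S] [MeasurableSingletonClass S]

/-- `ℙ_i(T_i > n)`. -/
noncomputable def returnTail (P : Matrix S S ℝ) (hP : P ∈ Matrix.rowStochastic ℝ S) (i : S)
    (n : ℕ) : ℝ :=
  (pathLaw P hP i).real {x | (n : ℕ∞) < returnTime i x}

/-- `𝔼_j[T_i]`. -/
noncomputable def expectedHitting (P : Matrix S S ℝ) (hP : P ∈ Matrix.rowStochastic ℝ S)
    (j i : S) : ℝ≥0∞ :=
  ∫⁻ x, (returnTime i x : ℝ≥0∞) ∂(pathLaw P hP j)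

/-- The maximal hitting time `H_i = max_j 𝔼_j[T_i]` (finite for an irreducible chain). -/
noncomputable def maxHitting (P : Matrix S S ℝ) (hP : P ∈ Matrix.rowStochastic ℝ S) (i : S) : ℝ :=
  (⨆ j, expectedHitting P hP j i).toReal

end ReturnTime

/-! The algorithm, run on the sample paths `w t k` (`t`: iteration, counted from `1`; `k`: number of
the sample within the iteration). In iteration `t` it looks at `w t 0, …, w t (N⁽ᵗ⁾ - 1)` only. All
quantities are defined for every `t ≥ 1`, also after the iteration in which the algorithm stops. -/

section Algorithm

variable {S : Type*}

/-- The truncation length `θ⁽ᵗ⁾ = 2ᵗ`. -/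
def theta (t : ℕ) : ℕ := 2 ^ t

/-- The length `min(T_i, θ)` of a sample path truncated at `θ`. -/
noncomputable def truncLength (i : S) (θ : ℕ) (x : ℕ → S) : ℕ :=
  (min (returnTime i x) (θ : ℕ∞)).toNat

/-- The mean length of the first `N` sample paths of iteration `t`, truncated at `θ⁽ᵗ⁾`. -/
noncomputable def meanLength (i : S) (w : ℕ → ℕ → ℕ → S) (t N : ℕ) : ℝ :=
  (∑ k ∈ Finset.range N, (truncLength i (theta t) (w t k) : ℝ)) / N

/-- The number `N⁽ᵗ⁾` of samples in iteration `t ≥ 1` (the value at `t = 0` is not used). -/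
noncomputable def numSamples (ε α : ℝ) (i : S) (w : ℕ → ℕ → ℕ → S) : ℕ → ℕ
  | 0 => 0
  | 1 => ⌈6 * (1 + ε) * Real.log (8 / α) / ε ^ 2⌉₊
  | t + 2 => ⌈3 * (1 + ε) * (theta (t + 2) : ℝ) * Real.log (4 * (theta (t + 2) : ℝ) / α) /
      (meanLength i w (t + 1) (numSamples ε α i w (t + 1)) * ε ^ 2)⌉₊

/-- `T̂_i⁽ᵗ⁾`. -/
noncomputable def estReturn (ε α : ℝ) (i : S) (w : ℕ → ℕ → ℕ → S) (t : ℕ) : ℝ :=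
  meanLength i w t (numSamples ε α i w t)

/-- The estimate `π̂_i⁽ᵗ⁾ = 1 / T̂_i⁽ᵗ⁾`. -/
noncomputable def estProb (ε α : ℝ) (i : S) (w : ℕ → ℕ → ℕ → S) (t : ℕ) : ℝ :=
  1 / estReturn ε α i w t

open Classical in
/-- `p̂⁽ᵗ⁾`: the fraction of the samples of iteration `t` that are truncated, i.e. have
`T_i > θ⁽ᵗ⁾`. -/
noncomputable def truncFraction (ε α : ℝ) (i : S) (w : ℕ → ℕ → ℕ → S) (t : ℕ) : ℝ :=
  (((Finset.range (numSamples ε α i w t)).filter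
    fun k => (theta t : ℕ∞) < returnTime i (w t k)).card : ℝ) / numSamples ε α i w t

/-- Condition (a) in iteration `t`: `π̂_i⁽ᵗ⁾ < Δ / (1 + ε)`. -/
def CondA (Δ ε α : ℝ) (i : S) (w : ℕ → ℕ → ℕ → S) (t : ℕ) : Prop :=
  estProb ε α i w t < Δ / (1 + ε)

/-- Condition (b) in iteration `t`: `p̂⁽ᵗ⁾ π̂_i⁽ᵗ⁾ < ε Δ`. -/
def CondB (Δ ε α : ℝ) (i : S) (w : ℕ → ℕ → ℕ → S) (t : ℕ) : Prop :=
  truncFraction ε α i w t * estProb ε α i w t < ε * Δ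

/-- The algorithm terminates in iteration `t`, at condition (b): it did not stop before, and in
iteration `t` condition (a), which is tested first, fails and condition (b) holds. -/
def StopsAtB (Δ ε α : ℝ) (i : S) (w : ℕ → ℕ → ℕ → S) (t : ℕ) : Prop :=
  1 ≤ t ∧ (∀ s, 1 ≤ s → s < t → ¬ CondA Δ ε α i w s ∧ ¬ CondB Δ ε α i w s) ∧
    ¬ CondA Δ ε α i w t ∧ CondB Δ ε α i w t

/-- The relative error `|(π̂_i⁽ᵗ⁾ - π_i) / π̂_i⁽ᵗ⁾|`. -/
noncomputable def relError (ε α : ℝ) (π : S → ℝ) (i : S) (w : ℕ → ℕ → ℕ → S) (t : ℕ) : ℝ :=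
  |(estProb ε α i w t - π i) / estProb ε α i w t|

end Algorithm

end TruncatedWalk

open TruncatedWalk

/-! Write θ for the truncation length, p = ℙ_i(T_i > θ) and m = 𝔼_i[min(T_i, θ)]. The relative error
equals |1 - π_i T̂|, so it splits into the bias 1 - π_i m and the sampling error of T̂ around m.

Bias. Let Q be the matrix of the chain killed on entering i, and g = ∑_{k<θ} Qᵏ(i,·) the occupation
measure up to min(T_i, θ). The run starts at i and ends at i unless it is truncated, so g(I - P) = p
δ_i - Q^θ(i,·). Multiplying g(I - P + 𝟙πᵀ) by Z, using πZ = π and reading off coordinate i gives 1 -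
π_i m = p Z_ii - ∑_q Q^θ(i,q) Z_qi, which is at most 2 p Z_max (`one_sub_stationary_mul_sum_eq`).
The bias is also ℙ_π(T_i > θ), hence nonnegative (`one_sub_stationary_mul_sum`). By Markov's
inequality, survival for ⌊2H_i⌋ steps has probability at most 1/2 from every state, which gives the
exponential tail (`returnTail_le`).

Sampling. N⁽ᵗ⁺¹⁾ is random but a function of earlier iterations, so it is independent of the samples
that it counts, and a Chernoff bound for each fixed size carries over (`measure_random_index_le`).
An accurate T̂⁽ᵗ⁾ is at most (1+ε) times the next truncated mean, which makes N⁽ᵗ⁺¹⁾ large enough;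
accuracy therefore propagates by induction. Iteration t fails with probability at most α/(2θ⁽ᵗ⁾), in
total α/2.

Condition (b). Together with the failure of (a) it forces p̂ < ε(1+ε). A second Chernoff bound, with
total failure α/4, gives p̂ > 2p/3 whenever 2(1-ε)p > 3ε. The two are incompatible, so 2(1-ε)p ≤ 3ε.
The failures add up to 3α/4 < α. -/

namespace TruncatedWalk

/-! ### The killed chain, the fundamental matrix and the bias of truncation -/

section Matrices

variable {S : Type*} {P : Matrix S S ℝ}

/-- The form in which irreducibility is used throughout: a property that holds at one state and
passes along edges holds everywhere. -/
theorem eq_univ_of_closed (hirr : P.IsIrreducible) {A : Set S} {x : S} (hx : x ∈ A)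
    (hA : ∀ y z, y ∈ A → 0 < P y z → z ∈ A) (y : S) : y ∈ A := by
  let := P.toQuiver
  obtain ⟨p, -⟩ := hirr.connected x y
  induction p with
  | nil => exact hx
  | cons p e ih => exact hA _ _ ih e.down

/-- By stationarity the zeros of π are closed under going to predecessors, hence the transposed
matrix. -/
theorem stationary_pos [Fintype S] {π : S → ℝ} (hirr : P.IsIrreducible)
    (hπ : IsStationaryDistribution P π) (x : S) : 0 < π x := by
  by_contra hx
  have hx0 : π x = 0 := le_antisymm (not_lt.1 hx) (hπ.nonneg x)
  have key : ∀ y, y ∈ {y | π y = 0} := by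
    refine eq_univ_of_closed (Matrix.IsIrreducible.transpose hirr) hx0 fun y z hy hyz => ?_
    have hy' : ∑ z, π z * P z y = 0 := by rw [← hπ.stationary]; exact hy
    rw [Finset.sum_eq_zero_iff_of_nonneg
      fun z _ => mul_nonneg (hπ.nonneg z) (hirr.nonneg z y)] at hy'
    exact (mul_eq_zero.1 (hy' z (Finset.mem_univ z))).resolve_right (ne_of_gt hyz)
  have := hπ.sum_eq_one
  rw [Finset.sum_eq_zero fun y _ => key y] at this
  exact zero_ne_one this

variable [DecidableEq S]

/-- The transition matrix of the chain killed when it enters `i`. -/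
def avoidMatrix (P : Matrix S S ℝ) (i : S) : Matrix S S ℝ :=
  Matrix.of fun x y => if y = i then 0 else P x y

theorem avoidMatrix_apply (i x y : S) : avoidMatrix P i x y = if y = i then 0 else P x y := rfl

variable [Fintype S]

/-- The probability, as a matrix expression, that the chain started at `j` does not visit `i` at
the times `1, …, n`. -/
def avoidProb (P : Matrix S S ℝ) (i : S) (n : ℕ) (j : S) : ℝ :=
  ∑ y, (avoidMatrix P i ^ n) j y

variable {π : S → ℝ} {i : S}

theorem avoidMatrix_nonneg (hP : P ∈ Matrix.rowStochastic ℝ S) (x y : S) :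
    0 ≤ avoidMatrix P i x y := by
  rw [avoidMatrix_apply]
  split_ifs
  exacts [le_rfl, Matrix.nonneg_of_mem_rowStochastic hP]

theorem avoidMatrix_pow_nonneg (hP : P ∈ Matrix.rowStochastic ℝ S) (n : ℕ) (x y : S) :
    0 ≤ (avoidMatrix P i ^ n) x y :=
  Matrix.pow_apply_nonneg (avoidMatrix_nonneg hP) n x y

theorem avoidProb_nonneg (hP : P ∈ Matrix.rowStochastic ℝ S) (n : ℕ) (j : S) :
    0 ≤ avoidProb P i n j :=
  Finset.sum_nonneg fun y _ => avoidMatrix_pow_nonneg hP n j y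

@[simp]
theorem avoidProb_zero (j : S) : avoidProb P i 0 j = 1 := by
  simp [avoidProb, Matrix.one_apply]

theorem avoidProb_add (m n : ℕ) (j : S) :
    avoidProb P i (m + n) j = ∑ y, (avoidMatrix P i ^ m) j y * avoidProb P i n y := by
  simp only [avoidProb, pow_add, Matrix.mul_apply, Finset.mul_sum]
  exact Finset.sum_comm

theorem avoidProb_succ (n : ℕ) (j : S) :
    avoidProb P i (n + 1) j = ∑ y, avoidMatrix P i j y * avoidProb P i n y := by
  rw [add_comm, avoidProb_add, pow_one]

theorem avoidProb_le_of_forall_le (hP : P ∈ Matrix.rowStochastic ℝ S) {n : ℕ} {c : ℝ}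
    (h : ∀ y, avoidProb P i n y ≤ c) (m : ℕ) (j : S) :
    avoidProb P i (m + n) j ≤ avoidProb P i m j * c := by
  rw [avoidProb_add, avoidProb, Finset.sum_mul]
  exact Finset.sum_le_sum fun y _ =>
    mul_le_mul_of_nonneg_left (h y) (avoidMatrix_pow_nonneg hP m j y)

theorem avoidProb_one_le (hP : P ∈ Matrix.rowStochastic ℝ S) (j : S) : avoidProb P i 1 j ≤ 1 := by
  rw [← Matrix.sum_row_of_mem_rowStochastic hP j, avoidProb, pow_one]
  refine Finset.sum_le_sum fun y _ => ?_
  rw [avoidMatrix_apply]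
  split_ifs
  exacts [Matrix.nonneg_of_mem_rowStochastic hP, le_rfl]

theorem avoidProb_antitone (hP : P ∈ Matrix.rowStochastic ℝ S) (j : S) :
    Antitone fun n => avoidProb P i n j :=
  antitone_nat_of_succ_le fun n => by
    simpa using avoidProb_le_of_forall_le hP (avoidProb_one_le hP) n j

theorem avoidProb_mul_le (hP : P ∈ Matrix.rowStochastic ℝ S) {n : ℕ} {c : ℝ} (hc : 0 ≤ c)
    (h : ∀ y, avoidProb P i n y ≤ c) (k : ℕ) (j : S) :
    avoidProb P i (k * n) j ≤ c ^ k := by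
  induction k with
  | zero => simp
  | succ k ih =>
    rw [Nat.succ_mul, pow_succ]
    exact (avoidProb_le_of_forall_le hP h _ j).trans (mul_le_mul_of_nonneg_right ih hc)

theorem avoidMatrix_pow_apply_self {n : ℕ} (hn : n ≠ 0) (x : S) :
    (avoidMatrix P i ^ n) x i = 0 := by
  obtain ⟨n, rfl⟩ := Nat.exists_eq_succ_of_ne_zero hn
  simp [pow_succ, Matrix.mul_apply, avoidMatrix_apply]

/-- Maximum principle: where f is maximal, its average over the successors is maximal too, so every
successor is a maximum. -/
theorem eq_of_harmonic (hP : P ∈ Matrix.rowStochastic ℝ S) (hirr : P.IsIrreducible) {f : S → ℝ}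
    (hf : ∀ x, f x = ∑ y, P x y * f y) (x y : S) : f x = f y := by
  have : Nonempty S := ⟨x⟩
  obtain ⟨z, hz⟩ := Finite.exists_max f
  suffices h : ∀ y, y ∈ {y | f y = f z} from (h x).trans (h y).symm
  refine eq_univ_of_closed hirr (x := z) rfl fun u v hu huv => ?_
  have hsum : ∑ y, P u y * (f z - f y) = 0 := by
    simp only [mul_sub, Finset.sum_sub_distrib, ← Finset.sum_mul,
      Matrix.sum_row_of_mem_rowStochastic hP, one_mul, ← hf]
    exact sub_eq_zero.2 (Eq.symm hu)
  rw [Finset.sum_eq_zero_iff_of_nonneg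
    fun y _ => mul_nonneg (hirr.nonneg u y) (sub_nonneg.2 (hz y))] at hsum
  have := (mul_eq_zero.1 (hsum v (Finset.mem_univ v))).resolve_left huv.ne'
  exact (sub_eq_zero.1 this).symm

/-- The matrix whose inverse is the fundamental matrix is invertible. -/
theorem isUnit_det_fundamental (hP : P ∈ Matrix.rowStochastic ℝ S) (hirr : P.IsIrreducible)
    (hπ : IsStationaryDistribution P π) :
    IsUnit (1 - P + Matrix.of fun _ y => π y : Matrix S S ℝ).det := by
  rw [isUnit_iff_ne_zero]
  intro hdet
  obtain ⟨v, hv0, hv⟩ := Matrix.exists_mulVec_eq_zero_iff.2 hdet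
  have hv' : ∀ x, v x - ∑ y, P x y * v y + ∑ y, π y * v y = 0 := fun x => by
    have := congrFun hv x
    rw [Matrix.add_mulVec, Matrix.sub_mulVec, Matrix.one_mulVec] at this
    exact this
  -- Averaging the kernel equation against π cancels v - Pv. What remains makes v harmonic, hence
  -- constant, with mean 0.
  have hπv : ∑ y, π y * v y = 0 := by
    have h1 : ∑ x, π x * (v x - ∑ y, P x y * v y + ∑ y, π y * v y) = 0 := by simp [hv']
    have h2 : ∑ x, π x * ∑ y, P x y * v y = ∑ y, π y * v y := by
      simp only [Finset.mul_sum]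
      rw [Finset.sum_comm]
      refine Finset.sum_congr rfl fun y _ => ?_
      conv_rhs => rw [hπ.stationary y, Finset.sum_mul]
      exact Finset.sum_congr rfl fun x _ => by ring
    simp only [mul_add, mul_sub, Finset.sum_add_distrib, Finset.sum_sub_distrib, h2, sub_self,
      zero_add, ← Finset.sum_mul, hπ.sum_eq_one, one_mul] at h1
    exact h1
  have hc := eq_of_harmonic hP hirr (f := v) fun x => by
    have := hv' x
    rw [hπv] at this
    linarith
  refine hv0 (funext fun x => ?_)
  have : ∑ y, π y * v y = v x := by
    rw [Finset.sum_congr rfl fun y _ => by rw [hc y x], ← Finset.sum_mul, hπ.sum_eq_one, one_mul]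
  rw [← this, hπv, Pi.zero_apply]

theorem vecMul_one_sub_add (g : S → ℝ) (y : S) :
    Matrix.vecMul g (1 - P + Matrix.of fun _ y => π y) y =
      g y - ∑ x, g x * P x y + (∑ x, g x) * π y := by
  rw [Matrix.vecMul_add, Matrix.vecMul_sub, Matrix.vecMul_one, Finset.sum_mul]
  rfl

theorem stationary_vecMul_fundamentalMatrix (hP : P ∈ Matrix.rowStochastic ℝ S)
    (hirr : P.IsIrreducible) (hπ : IsStationaryDistribution P π) :
    Matrix.vecMul π (fundamentalMatrix P π) = π := by
  have h : Matrix.vecMul π (1 - P + Matrix.of fun _ y => π y) = π := by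
    ext y
    rw [vecMul_one_sub_add, ← hπ.stationary, hπ.sum_eq_one, sub_self, zero_add, one_mul]
  conv_lhs => enter [1]; rw [← h]
  rw [fundamentalMatrix, Matrix.vecMul_vecMul,
    Matrix.mul_nonsing_inv _ (isUnit_det_fundamental hP hirr hπ), Matrix.vecMul_one]

theorem abs_fundamentalMatrix_le_Zmax (k i : S) : |fundamentalMatrix P π k i| ≤ Zmax P π i :=
  le_ciSup (f := fun k => |fundamentalMatrix P π k i|) (Set.finite_range _).bddAbove k

theorem Zmax_nonneg (i : S) : 0 ≤ Zmax P π i :=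
  (abs_nonneg _).trans (abs_fundamentalMatrix_le_Zmax i i)

/-- The truncated version of `π_i 𝔼_i[T_i] = 1`, for the chain started in stationarity. -/
theorem one_sub_stationary_mul_sum (hπ : IsStationaryDistribution P π) (n : ℕ) :
    1 - π i * ∑ k ∈ Finset.range n, avoidProb P i k i = ∑ q, π q * avoidProb P i n q := by
  induction n with
  | zero => simp [hπ.sum_eq_one]
  | succ n ih =>
    -- Stationarity reads πQ = π - π_i δ_i for the killed matrix Q, so each step loses exactly π_i
    -- ℙ_i(T_i > n).
    have hstep : ∑ q, π q * avoidProb P i (n + 1) q =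
        ∑ y, π y * avoidProb P i n y - π i * avoidProb P i n i := by
      simp only [avoidProb_succ, Finset.mul_sum]
      rw [Finset.sum_comm, eq_sub_iff_add_eq]
      have : ∀ y, ∑ x, π x * (avoidMatrix P i x y * avoidProb P i n y) =
          π y * avoidProb P i n y - if y = i then π i * avoidProb P i n i else 0 := fun y => by
        split_ifs with hy
        · subst hy; simp [avoidMatrix_apply]
        · simp only [avoidMatrix_apply, if_neg hy, sub_zero]
          conv_rhs => rw [hπ.stationary y, Finset.sum_mul]
          exact Finset.sum_congr rfl fun x _ => by ring
      simp [this, Finset.sum_sub_distrib]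
    rw [hstep, ← ih, Finset.sum_range_succ]
    ring

theorem stationary_mul_sum_le_one (hP : P ∈ Matrix.rowStochastic ℝ S)
    (hπ : IsStationaryDistribution P π) (n : ℕ) :
    π i * ∑ k ∈ Finset.range n, avoidProb P i k i ≤ 1 := by
  rw [← sub_nonneg, one_sub_stationary_mul_sum hπ]
  exact Finset.sum_nonneg fun q _ => mul_nonneg (hπ.nonneg q) (avoidProb_nonneg hP n q)

/-- The bias of the truncated mean return time, in terms of the fundamental matrix. -/
theorem one_sub_stationary_mul_sum_eq (hP : P ∈ Matrix.rowStochastic ℝ S) (hirr : P.IsIrreducible)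
    (hπ : IsStationaryDistribution P π) {n : ℕ} (hn : n ≠ 0) :
    1 - π i * ∑ k ∈ Finset.range n, avoidProb P i k i =
      avoidProb P i n i * fundamentalMatrix P π i i -
        ∑ q, (avoidMatrix P i ^ n) i q * fundamentalMatrix P π q i := by
  set Q := avoidMatrix P i with hQ
  set g : S → ℝ := fun y => ∑ k ∈ Finset.range n, (Q ^ k) i y with hg
  set m := ∑ k ∈ Finset.range n, avoidProb P i k i with hm
  have hgsum : ∑ y, g y = m := by
    rw [hg, hm, Finset.sum_comm]; rfl
  have hgi : g i = 1 := by
    rw [hg]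
    simp only
    -- The killed chain is at i only at time 0, so g counts a single visit.
    rw [Finset.sum_eq_single_of_mem 0 (Finset.mem_range.2 (Nat.pos_of_ne_zero hn))
      fun k _ hk => avoidMatrix_pow_apply_self hk i]
    simp
  have hgQ : ∀ y, ∑ x, g x * Q x y = g y - (1 : Matrix S S ℝ) i y + (Q ^ n) i y := fun y => by
    simp only [hg, Finset.sum_mul]
    rw [Finset.sum_comm]
    have : ∀ k, ∑ x, (Q ^ k) i x * Q x y = (Q ^ (k + 1)) i y := fun k => by
      rw [pow_succ, Matrix.mul_apply]
    simp only [this]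
    have h1 := Finset.sum_range_succ (fun k => (Q ^ k) i y) n
    rw [Finset.sum_range_succ'] at h1
    simp only [pow_zero] at h1
    linarith
  have hgP : ∀ y, y ≠ i → ∑ x, g x * P x y = g y + (Q ^ n) i y := fun y hy => by
    rw [← sub_zero (g y), ← Matrix.one_apply_ne' (α := ℝ) hy, ← hgQ]
    simp [hQ, avoidMatrix_apply, hy]
  -- Column i is missing from Q, so this entry comes from conservation of mass: gP and g have the
  -- same total m.
  have hgPi : ∑ x, g x * P x i = 1 - avoidProb P i n i := by
    have htot : ∑ y, ∑ x, g x * P x y = m := by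
      rw [Finset.sum_comm]
      simp [← Finset.mul_sum, Matrix.sum_row_of_mem_rowStochastic hP, hgsum]
    have hn0 : (Q ^ n) i i = 0 := avoidMatrix_pow_apply_self hn i
    rw [← Finset.add_sum_erase _ _ (Finset.mem_univ i),
      Finset.sum_congr rfl fun y hy => hgP y (Finset.ne_of_mem_erase hy),
      Finset.sum_add_distrib] at htot
    have h1 := Finset.add_sum_erase _ g (Finset.mem_univ i)
    have h2 := Finset.add_sum_erase _ (fun y => (Q ^ n) i y) (Finset.mem_univ i)
    change _ = avoidProb P i n i at h2
    simp only [hn0] at h2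
    linarith
  have hvec : Matrix.vecMul g (1 - P + Matrix.of fun _ y => π y) =
      avoidProb P i n i • Pi.single i 1 - (fun y => (Q ^ n) i y) + m • π := by
    ext y
    rw [vecMul_one_sub_add, hgsum]
    simp only [Pi.add_apply, Pi.sub_apply, Pi.smul_apply, smul_eq_mul]
    rcases eq_or_ne y i with rfl | hy
    · rw [hgPi, hgi, avoidMatrix_pow_apply_self hn]; simp
    · rw [hgP y hy]; simp [hy]
  have hZ : g = Matrix.vecMul (avoidProb P i n i • Pi.single i 1 - (fun y => (Q ^ n) i y) + m • π)
      (fundamentalMatrix P π) := by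
    rw [← hvec, Matrix.vecMul_vecMul, fundamentalMatrix,
      Matrix.mul_nonsing_inv _ (isUnit_det_fundamental hP hirr hπ), Matrix.vecMul_one]
  have hi := congrFun hZ i
  rw [hgi, Matrix.add_vecMul, Matrix.sub_vecMul, Matrix.smul_vecMul, Matrix.smul_vecMul,
    stationary_vecMul_fundamentalMatrix hP hirr hπ] at hi
  simp only [Pi.add_apply, Pi.sub_apply, Pi.smul_apply, smul_eq_mul, Matrix.single_one_vecMul,
    Matrix.row_apply] at hi
  have e3 : Matrix.vecMul (fun y => (Q ^ n) i y) (fundamentalMatrix P π) i =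
    ∑ q, (Q ^ n) i q * fundamentalMatrix P π q i := rfl
  rw [e3] at hi
  linarith

theorem one_sub_stationary_mul_sum_le (hP : P ∈ Matrix.rowStochastic ℝ S) (hirr : P.IsIrreducible)
    (hπ : IsStationaryDistribution P π) {n : ℕ} (hn : n ≠ 0) :
    1 - π i * ∑ k ∈ Finset.range n, avoidProb P i k i ≤ 2 * avoidProb P i n i * Zmax P π i := by
  rw [one_sub_stationary_mul_sum_eq hP hirr hπ hn]
  have h1 : avoidProb P i n i * fundamentalMatrix P π i i ≤ avoidProb P i n i * Zmax P π i :=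
    mul_le_mul_of_nonneg_left ((le_abs_self _).trans (abs_fundamentalMatrix_le_Zmax i i))
      (avoidProb_nonneg hP n i)
  have h2 : -∑ q, (avoidMatrix P i ^ n) i q * fundamentalMatrix P π q i ≤
      avoidProb P i n i * Zmax P π i := by
    rw [← Finset.sum_neg_distrib, avoidProb, Finset.sum_mul]
    refine Finset.sum_le_sum fun q _ => ?_
    rw [← mul_neg]
    exact mul_le_mul_of_nonneg_left ((neg_le_abs _).trans (abs_fundamentalMatrix_le_Zmax q i))
      (avoidMatrix_pow_nonneg hP n i q)
  linarith

/-- The truncated mean hitting times of `i` are bounded. -/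
theorem exists_sum_avoidProb_le (hP : P ∈ Matrix.rowStochastic ℝ S) (hirr : P.IsIrreducible)
    (hπ : IsStationaryDistribution P π) (j : S) :
    ∃ C : ℝ, ∀ n, ∑ k ∈ Finset.range n, avoidProb P i k j ≤ C := by
  have hi : ∃ C : ℝ, ∀ n, ∑ k ∈ Finset.range n, avoidProb P i k i ≤ C :=
    ⟨1 / π i, fun n => by
      rw [le_div_iff₀ (stationary_pos hirr hπ i), mul_comm]
      exact stationary_mul_sum_le_one hP hπ n⟩
  -- The mean is finite at i since π_i > 0, and finiteness passes from y to any z ≠ i with P y z >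
  -- 0: the mean from y is at least P y z times the mean from z.
  refine eq_univ_of_closed (A := {j | ∃ C : ℝ, ∀ n, ∑ k ∈ Finset.range n, avoidProb P i k j ≤ C})
    hirr hi (fun y z hy hyz => ?_) j
  rcases eq_or_ne z i with rfl | hz
  · exact hi
  obtain ⟨C, hC⟩ := hy
  refine ⟨C / P y z, fun n => ?_⟩
  rw [le_div_iff₀ hyz]
  refine le_trans ?_ (hC (n + 1))
  rw [Finset.sum_range_succ', Finset.sum_mul]
  refine le_add_of_le_of_nonneg (Finset.sum_le_sum fun k _ => ?_) (by simp)
  rw [avoidProb_succ]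
  refine le_trans ?_ (Finset.single_le_sum (f := fun x => avoidMatrix P i y x * avoidProb P i k x)
    (fun x _ => mul_nonneg (avoidMatrix_nonneg hP y x) (avoidProb_nonneg hP k x))
    (Finset.mem_univ z))
  simp [avoidMatrix_apply, hz, mul_comm]

end Matrices

/-! ### The return time as a sum of tail indicators -/

section ReturnTimeBasics

variable {S : Type*} {i : S}

theorem lt_returnTime_iff (n : ℕ) (x : ℕ → S) :
    (n : ℕ∞) < returnTime i x ↔ ∀ k, 1 ≤ k → k ≤ n → x k ≠ i := by
  rw [← not_le]
  constructor
  · intro h k h1 hk hx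
    exact h ((iInf₂_le k ⟨h1, hx⟩).trans (Nat.cast_le.2 hk))
  · intro h hle
    have : ((n + 1 : ℕ) : ℕ∞) ≤ returnTime i x :=
      le_iInf₂ fun k hk => Nat.cast_le.2 <| by
        by_contra hkn
        exact h k hk.1 (by omega) hk.2
    exact absurd (Nat.cast_le.1 (this.trans hle)) (by omega)

theorem truncLength_eq_sum (θ : ℕ) (x : ℕ → S) [∀ n : ℕ, Decidable ((n : ℕ∞) < returnTime i x)] :
    truncLength i θ x =
      ∑ n ∈ Finset.range θ, if (n : ℕ∞) < returnTime i x then 1 else 0 := by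
  rw [truncLength, Finset.sum_boole]
  rcases eq_or_ne (returnTime i x) ⊤ with h | h
  · simp [h]
  obtain ⟨m, h⟩ := ENat.ne_top_iff_exists.1 h
  · simp only [← h]
    have : (Finset.range θ).filter (fun n : ℕ => (n : ℕ∞) < (m : ℕ∞)) = Finset.range (min m θ) := by
      ext n; simp [and_comm]
    rw [this, ← Nat.mono_cast.map_min, ENat.toNat_natCast, Finset.card_range, Nat.cast_id]

theorem truncLength_le (θ : ℕ) (x : ℕ → S) : truncLength i θ x ≤ θ := by
  classical
  rw [truncLength_eq_sum]
  refine (Finset.sum_le_card_nsmul _ _ 1 fun n _ => ?_).trans (by simp)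
  split_ifs <;> simp

theorem one_le_truncLength {θ : ℕ} (hθ : θ ≠ 0) (x : ℕ → S) : 1 ≤ truncLength i θ x := by
  classical
  rw [truncLength_eq_sum]
  refine le_trans ?_ (Finset.single_le_sum (fun n _ => Nat.zero_le _)
    (Finset.mem_range.2 (Nat.pos_of_ne_zero hθ)))
  rw [if_pos]
  exact (lt_returnTime_iff 0 x).2 fun k h1 h2 => absurd h1 (by omega)

theorem returnTime_eq_tsum (x : ℕ → S) [∀ n : ℕ, Decidable ((n : ℕ∞) < returnTime i x)] :
    (returnTime i x : ℝ≥0∞) = ∑' n : ℕ, if (n : ℕ∞) < returnTime i x then 1 else 0 := by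
  rcases eq_or_ne (returnTime i x) ⊤ with h | h
  · simp [h]
  obtain ⟨m, h⟩ := ENat.ne_top_iff_exists.1 h
  · simp only [← h]
    rw [tsum_eq_sum (s := Finset.range m)]
    · rw [Finset.sum_congr rfl fun n hn => if_pos (by simpa using hn)]
      simp
    · intro n hn
      rw [if_neg (by simpa using hn)]

variable [MeasurableSpace S] [MeasurableSingletonClass S]

theorem measurableSet_coord_eq {ι : Type*} (k : ι) (y : S) :
    MeasurableSet {x : ι → S | x k = y} :=
  measurableSet_preimage (f := fun x : ι → S => x k) (t := {y}) (measurable_pi_apply k)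
    (measurableSet_singleton y)

theorem measurableSet_lt_returnTime (n : ℕ) :
    MeasurableSet {x : ℕ → S | (n : ℕ∞) < returnTime i x} := by
  have : {x : ℕ → S | (n : ℕ∞) < returnTime i x} =
      ⋂ (k : ℕ) (_ : 1 ≤ k) (_ : k ≤ n), {x | x k = i}ᶜ := by
    ext x; simp [lt_returnTime_iff]
  rw [this]
  exact MeasurableSet.iInter fun k => MeasurableSet.iInter fun _ => MeasurableSet.iInter fun _ =>
    (measurableSet_coord_eq k i).compl

theorem measurable_truncLength (θ : ℕ) : Measurable (truncLength i θ : (ℕ → S) → ℕ) := by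
  classical
  have : (truncLength i θ : (ℕ → S) → ℕ) = fun x => ∑ n ∈ Finset.range θ,
      if (n : ℕ∞) < returnTime i x then 1 else 0 := funext fun x => truncLength_eq_sum θ x
  rw [this]
  exact Finset.measurable_fun_sum _ fun n _ =>
    Measurable.ite (measurableSet_lt_returnTime n) measurable_const measurable_const

end ReturnTimeBasics

/-! ### The law of the return time on trajectory space, and its exponential tail -/

section PathLaw

variable {S : Type*} [Fintype S] [DecidableEq S] [MeasurableSpace S] [MeasurableSingletonClass S]
  {P : Matrix S S ℝ} {π : S → ℝ} {i : S}

theorem isProbabilityMeasure_pathLaw (hP : P ∈ Matrix.rowStochastic ℝ S) (j : S) :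
    IsProbabilityMeasure (pathLaw P hP j) := by
  have := isMarkovKernel_historyKernel hP
  unfold pathLaw
  infer_instance

theorem stepKernel_singleton (x y : S) : stepKernel P x {y} = ENNReal.ofReal (P x y) := by
  have h : stepKernel P x = ∑ y, ENNReal.ofReal (P x y) • Measure.dirac y := rfl
  rw [h, Measure.coe_finsetSum, Finset.sum_apply]
  simp_rw [Measure.smul_apply, smul_eq_mul, Measure.dirac_apply' _ (measurableSet_singleton y)]
  simp [Set.indicator_apply]

/-- The Markov property for one step. -/
theorem pathLaw_step (hP : P ∈ Matrix.rowStochastic ℝ S) (j : S) {n : ℕ}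
    {B : Set ((_ : Finset.Iic n) → S)} (hB : MeasurableSet B) {z : S}
    (hz : ∀ h ∈ B, h ⟨n, Finset.mem_Iic.2 le_rfl⟩ = z) (y : S) :
    pathLaw P hP j {x | Preorder.frestrictLe (π := fun _ => S) n x ∈ B ∧ x (n + 1) = y} =
      pathLaw P hP j {x | Preorder.frestrictLe (π := fun _ => S) n x ∈ B} *
        ENNReal.ofReal (P z y) := by
  have := isMarkovKernel_historyKernel hP
  have hmap := Kernel.partialTraj_compProd_eq_map_traj (X := fun _ => S) (κ := historyKernel P)
    (Nat.zero_le n) (x₀ := fun _ => j)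
  have hms : MeasurableSet (B ×ˢ ({y} : Set S)) := hB.prod (measurableSet_singleton y)
  have h1 := congrArg (fun m => m (B ×ˢ ({y} : Set S))) hmap
  rw [Measure.map_apply (by fun_prop) hms,
    Measure.compProd_apply_prod hB (measurableSet_singleton y)]
    at h1
  have h2 : pathLaw P hP j {x | Preorder.frestrictLe (π := fun _ => S) n x ∈ B} =
      Kernel.partialTraj (X := fun _ => S) (historyKernel P) 0 n (fun _ => j) B := by
    rw [← Kernel.traj_map_frestrictLe_apply,
      Measure.map_apply (Preorder.measurable_frestrictLe n) hB]
    rfl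
  refine h1.symm.trans ?_
  rw [h2, mul_comm, ← setLIntegral_const]
  refine setLIntegral_congr_fun hB fun h hh => ?_
  rw [historyKernel, Kernel.comap_apply, stepKernel_singleton, hz h hh]

theorem pathLaw_start (hP : P ∈ Matrix.rowStochastic ℝ S) (j y : S) :
    pathLaw P hP j {x | x 0 = y} = if j = y then 1 else 0 := by
  have := isMarkovKernel_historyKernel hP
  have h1 := Kernel.traj_map_frestrictLe_apply (X := fun _ => S) (κ := historyKernel P) 0 0
    (fun _ => j)
  rw [Kernel.partialTraj_self, Kernel.id_apply] at h1
  have hms : MeasurableSet {h : (_ : Finset.Iic 0) → S | h ⟨0, Finset.mem_Iic.2 le_rfl⟩ = y} :=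
    measurableSet_coord_eq _ y
  have h2 := congrArg (fun m => m {h : (_ : Finset.Iic 0) → S |
    h ⟨0, Finset.mem_Iic.2 le_rfl⟩ = y}) h1
  rw [Measure.map_apply (by fun_prop) hms, Measure.dirac_apply' _ hms] at h2
  refine Eq.trans ?_ (h2.trans ?_)
  · rfl
  · simp [Set.indicator_apply]

/-- Recording the current state along with the survival event lets the one-step Markov property turn
into multiplication by the killed matrix. -/
theorem pathLaw_lt_returnTime_and_eq (hP : P ∈ Matrix.rowStochastic ℝ S) (j : S) (n : ℕ) (y : S) :
    pathLaw P hP j {x | (n : ℕ∞) < returnTime i x ∧ x n = y} =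
      ENNReal.ofReal ((avoidMatrix P i ^ n) j y) := by
  induction n generalizing y with
  | zero =>
    have : {x : ℕ → S | ((0 : ℕ) : ℕ∞) < returnTime i x ∧ x 0 = y} = {x | x 0 = y} := by
      ext x
      simp only [Set.mem_ofPred_eq, and_iff_right_iff_imp]
      exact fun _ => (lt_returnTime_iff 0 x).2 fun k h1 h2 => absurd h1 (by omega)
    rw [this, pathLaw_start, pow_zero, Matrix.one_apply]
    split_ifs <;> simp
  | succ n ih =>
    rcases eq_or_ne y i with rfl | hy
    · have : {x : ℕ → S | ((n + 1 : ℕ) : ℕ∞) < returnTime y x ∧ x (n + 1) = y} = ∅ := by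
        ext x
        simp only [Set.mem_ofPred_eq, Set.mem_empty_iff_false, iff_false, not_and]
        exact fun h => (lt_returnTime_iff _ x).1 h _ (by omega) le_rfl
      rw [this, avoidMatrix_pow_apply_self (Nat.succ_ne_zero n)]
      simp
    · let B : S → Set ((_ : Finset.Iic n) → S) := fun z =>
        {h | (∀ k : Finset.Iic n, 1 ≤ (k : ℕ) → h k ≠ i) ∧ h ⟨n, Finset.mem_Iic.2 le_rfl⟩ = z}
      have hBm : ∀ z, MeasurableSet (B z) := fun z => by
        have : B z = (⋂ (k : Finset.Iic n) (_ : 1 ≤ (k : ℕ)), {h | h k = i}ᶜ) ∩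
            {h | h ⟨n, Finset.mem_Iic.2 le_rfl⟩ = z} := by
          ext h; simp [B]
        rw [this]
        exact (MeasurableSet.iInter fun k => MeasurableSet.iInter fun _ =>
          (measurableSet_coord_eq k i).compl).inter (measurableSet_coord_eq _ z)
      have hB : ∀ z, {x : ℕ → S | Preorder.frestrictLe (π := fun _ => S) n x ∈ B z} =
          {x | (n : ℕ∞) < returnTime i x ∧ x n = z} := fun z => by
        ext x
        simp only [Set.mem_ofPred_eq, B, lt_returnTime_iff]
        refine and_congr ⟨fun h k h1 h2 => h ⟨k, Finset.mem_Iic.2 h2⟩ h1, fun h k h1 => ?_⟩ Iff.rfl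
        exact h k h1 (Finset.mem_Iic.1 k.2)
      have hunion : {x : ℕ → S | ((n + 1 : ℕ) : ℕ∞) < returnTime i x ∧ x (n + 1) = y} =
          ⋃ z, {x | Preorder.frestrictLe (π := fun _ => S) n x ∈ B z ∧ x (n + 1) = y} := by
        ext x
        have hx : ∀ z, Preorder.frestrictLe (π := fun _ => S) n x ∈ B z ↔
            (n : ℕ∞) < returnTime i x ∧ x n = z :=
          fun z => Set.ext_iff.1 (hB z) x
        simp only [Set.mem_ofPred_eq, Set.mem_iUnion, hx, lt_returnTime_iff]
        constructor
        · rintro ⟨h, rfl⟩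
          exact ⟨x n, ⟨fun k h1 h2 => h k h1 (by omega), rfl⟩, rfl⟩
        · rintro ⟨z, ⟨h, -⟩, rfl⟩
          refine ⟨fun k h1 h2 => ?_, rfl⟩
          rcases Nat.lt_or_ge n k with hk | hk
          · obtain rfl : k = n + 1 := by omega
            exact hy
          · exact h k h1 hk
      rw [hunion, measure_iUnion]
      · simp only [pathLaw_step hP j (hBm _) (fun h hh => hh.2), hB, ih]
        rw [tsum_fintype, pow_succ, Matrix.mul_apply, ENNReal.ofReal_sum_of_nonneg
          fun z _ => mul_nonneg (avoidMatrix_pow_nonneg hP n j z) (avoidMatrix_nonneg hP z y)]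
        refine Finset.sum_congr rfl fun z _ => ?_
        rw [ENNReal.ofReal_mul (avoidMatrix_pow_nonneg hP n j z), avoidMatrix_apply, if_neg hy]
      · intro z z' hzz
        refine Set.disjoint_left.2 fun x hx hx' => hzz ?_
        exact hx.1.2.symm.trans hx'.1.2
      · intro z
        exact ((Preorder.measurable_frestrictLe n) (hBm z)).inter
          (measurableSet_coord_eq _ y)

theorem pathLaw_lt_returnTime (hP : P ∈ Matrix.rowStochastic ℝ S) (j : S) (n : ℕ) :
    pathLaw P hP j {x | (n : ℕ∞) < returnTime i x} = ENNReal.ofReal (avoidProb P i n j) := by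
  have hunion : {x : ℕ → S | (n : ℕ∞) < returnTime i x} =
      ⋃ y, {x | (n : ℕ∞) < returnTime i x ∧ x n = y} := by
    ext x; simp
  rw [hunion, measure_iUnion]
  · simp only [pathLaw_lt_returnTime_and_eq]
    rw [tsum_fintype, avoidProb, ENNReal.ofReal_sum_of_nonneg
      fun z _ => avoidMatrix_pow_nonneg hP n j z]
  · intro z z' hzz
    exact Set.disjoint_left.2 fun x hx hx' => hzz (hx.2.symm.trans hx'.2)
  · intro z
    exact (measurableSet_lt_returnTime n).inter
      (measurableSet_coord_eq _ z)

theorem returnTail_eq (hP : P ∈ Matrix.rowStochastic ℝ S) (n : ℕ) :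
    returnTail P hP i n = avoidProb P i n i := by
  rw [returnTail, Measure.real, pathLaw_lt_returnTime,
    ENNReal.toReal_ofReal (avoidProb_nonneg hP n i)]

theorem integral_truncLength (hP : P ∈ Matrix.rowStochastic ℝ S) (j : S) (θ : ℕ) :
    ∫ x, (truncLength i θ x : ℝ) ∂(pathLaw P hP j) =
      ∑ n ∈ Finset.range θ, avoidProb P i n j := by
  classical
  have := isProbabilityMeasure_pathLaw hP j
  have h : ∀ x : ℕ → S, (truncLength i θ x : ℝ) = ∑ n ∈ Finset.range θ,
      Set.indicator {x : ℕ → S | (n : ℕ∞) < returnTime i x} (fun _ => (1 : ℝ)) x := fun x => by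
    rw [truncLength_eq_sum]
    push_cast
    exact Finset.sum_congr rfl fun n _ => by simp [Set.indicator_apply]
  simp only [h]
  rw [integral_finsetSum _ fun n _ =>
    (integrable_const (1 : ℝ)).indicator (measurableSet_lt_returnTime n)]
  refine Finset.sum_congr rfl fun n _ => ?_
  rw [integral_indicator_const _ (measurableSet_lt_returnTime n), smul_eq_mul, mul_one,
    Measure.real, pathLaw_lt_returnTime, ENNReal.toReal_ofReal (avoidProb_nonneg hP n j)]

theorem expectedHitting_eq_tsum (hP : P ∈ Matrix.rowStochastic ℝ S) (j : S) :
    expectedHitting P hP j i = ∑' n, ENNReal.ofReal (avoidProb P i n j) := by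
  classical
  have h : ∀ x : ℕ → S, (returnTime i x : ℝ≥0∞) = ∑' n : ℕ,
      Set.indicator {x : ℕ → S | (n : ℕ∞) < returnTime i x} (fun _ => (1 : ℝ≥0∞)) x := fun x => by
    rw [returnTime_eq_tsum]
    exact tsum_congr fun n => by simp [Set.indicator_apply]
  rw [expectedHitting]
  simp only [h]
  rw [lintegral_tsum fun n =>
    (measurable_const.indicator (measurableSet_lt_returnTime n)).aemeasurable]
  refine tsum_congr fun n => ?_
  rw [lintegral_indicator_const (measurableSet_lt_returnTime n), one_mul, pathLaw_lt_returnTime]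

theorem sum_avoidProb_le_maxHitting (hP : P ∈ Matrix.rowStochastic ℝ S) (hirr : P.IsIrreducible)
    (hπ : IsStationaryDistribution P π) (j : S) (n : ℕ) :
    ∑ k ∈ Finset.range n, avoidProb P i k j ≤ maxHitting P hP i := by
  have hpart : ∀ (j : S) (n : ℕ), ∑ k ∈ Finset.range n, ENNReal.ofReal (avoidProb P i k j) =
      ENNReal.ofReal (∑ k ∈ Finset.range n, avoidProb P i k j) := fun j n =>
    (ENNReal.ofReal_sum_of_nonneg fun k _ => avoidProb_nonneg hP k j).symm
  have hfin : ∀ j, expectedHitting P hP j i < ∞ := fun j => by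
    obtain ⟨C, hC⟩ := exists_sum_avoidProb_le (i := i) hP hirr hπ j
    rw [expectedHitting_eq_tsum]
    refine (ENNReal.tsum_le_of_sum_range_le fun n => ?_).trans_lt (ENNReal.ofReal_lt_top (r := C))
    rw [hpart]
    exact ENNReal.ofReal_le_ofReal (hC n)
  -- Finiteness matters: `maxHitting` is a `toReal`, which would be 0 at `∞`.
  have hsup : (⨆ j, expectedHitting P hP j i) ≠ ∞ := by
    have : Nonempty S := ⟨i⟩
    obtain ⟨j, hj⟩ := exists_eq_ciSup_of_finite (f := fun j => expectedHitting P hP j i)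
    rw [← hj]
    exact (hfin j).ne
  rw [maxHitting, ← ENNReal.ofReal_le_iff_le_toReal hsup, ← hpart]
  exact ((ENNReal.sum_le_tsum _).trans_eq (expectedHitting_eq_tsum hP j).symm).trans
    (le_iSup (fun j => expectedHitting P hP j i) j)

/-- The return time has an exponential tail, at a rate given by the maximal hitting time. -/
theorem returnTail_le (hP : P ∈ Matrix.rowStochastic ℝ S) (hirr : P.IsIrreducible)
    (hπ : IsStationaryDistribution P π) (n : ℕ) :
    returnTail P hP i n ≤ 2 * (2 : ℝ) ^ (-((n : ℝ) / (2 * maxHitting P hP i))) := by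
  set H := maxHitting P hP i with hH
  have hH1 : 1 ≤ H := by
    simpa using sum_avoidProb_le_maxHitting (i := i) hP hirr hπ i 1
  set N := ⌊2 * H⌋₊ with hN
  have hN1 : 1 ≤ N := Nat.le_floor (by push_cast; linarith)
  have hNle : (N : ℝ) ≤ 2 * H := Nat.floor_le (by linarith)
  have hNlt : 2 * H < N + 1 := Nat.lt_floor_add_one _
  -- Markov's inequality in summed form: N + 1 tail terms, none below the last one, sum to at most H
  -- < (N + 1)/2.
  have hhalf : ∀ y, avoidProb P i N y ≤ 1 / 2 := fun y => by
    have h1 := sum_avoidProb_le_maxHitting (i := i) hP hirr hπ y (N + 1)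
    have h2 : (N + 1) * avoidProb P i N y ≤ ∑ k ∈ Finset.range (N + 1), avoidProb P i k y := by
      refine le_trans (by simp) (Finset.card_nsmul_le_sum _ _ (avoidProb P i N y) fun k hk =>
        avoidProb_antitone hP y (Nat.lt_succ_iff.1 (Finset.mem_range.1 hk)))
    have h3 := avoidProb_nonneg (i := i) hP N y
    nlinarith
  rw [returnTail_eq]
  set k := n / N with hk
  have hkn : avoidProb P i n i ≤ (1 / 2) ^ k :=
    (avoidProb_antitone hP i (Nat.div_mul_le_self n N)).trans
      (avoidProb_mul_le hP (by norm_num) hhalf k i)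
  refine hkn.trans ?_
  -- Here n < (k + 1)N and N ≤ 2H. Rounding n/N down costs the factor 2 in the final bound.
  have hnk : (n : ℝ) / (2 * H) ≤ k + 1 := by
    rw [div_le_iff₀ (by linarith)]
    have : n < (k + 1) * N := by
      rw [mul_comm]; exact Nat.lt_mul_div_succ n hN1
    have h' : (n : ℝ) ≤ (k + 1) * N := by exact_mod_cast this.le
    nlinarith [Nat.cast_nonneg (α := ℝ) k]
  calc (1 / 2 : ℝ) ^ k = 2 * (2 : ℝ) ^ (-((k : ℝ) + 1)) := by
        rw [Real.rpow_neg (by norm_num), Real.rpow_add (by norm_num), Real.rpow_natCast,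
          Real.rpow_one]
        simp [mul_comm]
    _ ≤ _ := by
        gcongr
        norm_num

end PathLaw

/-! ### Multiplicative Chernoff bounds for variables in [0, M] -/

section Chernoff

/-- On [0, M] the convex exponential lies below its chord. -/
theorem exp_mul_le_one_add {M y : ℝ} (hM : 0 < M) (h0 : 0 ≤ y) (h1 : y ≤ M) (s : ℝ) :
    Real.exp (s * y) ≤ 1 + y / M * (Real.exp (s * M) - 1) := by
  have h := convexOn_exp.2 (Set.mem_univ (0 : ℝ)) (Set.mem_univ (s * M))
    (sub_nonneg.2 ((div_le_one hM).2 h1)) (div_nonneg h0 hM.le) (sub_add_cancel 1 (y / M))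
  simp only [smul_eq_mul, mul_zero, zero_add, Real.exp_zero, mul_one] at h
  have e : y / M * (s * M) = s * y := by field_simp
  rw [e] at h
  linarith

/-- The exponent 2e/3 stands in for the optimal log(1 + e); a third-order Taylor bound then already
yields the constant 1/3. -/
theorem exp_two_thirds_mul_le {e : ℝ} (h0 : 0 ≤ e) (h1 : e ≤ 1) :
    Real.exp (2 / 3 * e) - 1 - 2 / 3 * e * (1 + e) ≤ -(e ^ 2 / 3) := by
  have h := Real.exp_bound' (x := 2 / 3 * e) (by linarith) (by linarith) (n := 3) (by norm_num)
  simp only [Finset.sum_range_succ, Finset.sum_range_zero, Nat.factorial] at h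
  norm_num at h
  nlinarith [mul_nonneg (sq_nonneg e) (sub_nonneg.2 h1)]

/-- Rests on (1 + d + d²/2)(1 - d + d²/2) = 1 + d⁴/4 ≥ 1. -/
theorem exp_neg_le {d : ℝ} (h0 : 0 ≤ d) :
    Real.exp (-d) - 1 + d * (1 - d) ≤ -(d ^ 2 / 2) := by
  have h := Real.quadratic_le_exp_of_nonneg h0
  have hpos : 0 < 1 + d + d ^ 2 / 2 := by positivity
  have h2 : Real.exp (-d) ≤ 1 / (1 + d + d ^ 2 / 2) := by
    rw [Real.exp_neg, inv_eq_one_div]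
    exact one_div_le_one_div_of_le hpos h
  have h3 : 1 / (1 + d + d ^ 2 / 2) ≤ 1 - d + d ^ 2 / 2 := by
    rw [div_le_iff₀ hpos]
    nlinarith [sq_nonneg (d ^ 2)]
  linarith

variable {Ω : Type*} [MeasurableSpace Ω] {μ : Measure Ω} [IsProbabilityMeasure μ]
  {Y : ℕ → Ω → ℝ} {M m : ℝ}

/-- The chord bound and 1 + x ≤ exp x compare each factor with a Poisson variable of mean m/M,
scaled by M. -/
theorem mgf_sum_le (hind : iIndepFun Y μ) (hY : ∀ k, Measurable (Y k)) (hM : 0 < M)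
    (h0 : ∀ k ω, 0 ≤ Y k ω) (h1 : ∀ k ω, Y k ω ≤ M) (hm : ∀ k, ∫ ω, Y k ω ∂μ = m) (N : ℕ) (s : ℝ) :
    mgf (∑ k ∈ Finset.range N, Y k) μ s ≤ Real.exp (N * (m / M * (Real.exp (s * M) - 1))) := by
  rw [hind.mgf_sum hY, Real.exp_nat_mul]
  refine (Finset.prod_le_prod (fun k _ => mgf_nonneg) fun k _ => ?_).trans_eq
    (by rw [Finset.prod_const, Finset.card_range])
  have hint : Integrable (Y k) μ :=
    Integrable.of_bound (hY k).aestronglyMeasurable M (ae_of_all _ fun ω => by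
      rw [Real.norm_of_nonneg (h0 k ω)]; exact h1 k ω)
  have hint' : Integrable (fun ω => 1 + Y k ω / M * (Real.exp (s * M) - 1)) μ :=
    (integrable_const _).add ((hint.div_const M).mul_const _)
  have h : mgf (Y k) μ s ≤ ∫ ω, 1 + Y k ω / M * (Real.exp (s * M) - 1) ∂μ :=
    integral_mono_of_nonneg (ae_of_all _ fun ω => (Real.exp_pos _).le) hint'
      (ae_of_all _ fun ω => exp_mul_le_one_add hM (h0 k ω) (h1 k ω) s)
  rw [integral_add (integrable_const _) ((hint.div_const M).mul_const _), integral_mul_const,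
    integral_div, hm, integral_const, probReal_univ, one_smul] at h
  refine h.trans ?_
  rw [add_comm]
  exact Real.add_one_le_exp _

theorem integrable_exp_mul_sum (hY : ∀ k, Measurable (Y k)) (h0 : ∀ k ω, 0 ≤ Y k ω)
    (h1 : ∀ k ω, Y k ω ≤ M) (N : ℕ) (s : ℝ) :
    Integrable (fun ω => Real.exp (s * (∑ k ∈ Finset.range N, Y k) ω)) μ := by
  refine Integrable.of_bound (C := Real.exp (|s| * (N * M))) (by fun_prop)
    (ae_of_all _ fun ω => ?_)
  rw [Real.norm_of_nonneg (Real.exp_pos _).le, Finset.sum_apply]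
  refine Real.exp_le_exp.2 (mul_le_mul (le_abs_self s) ?_
    (Finset.sum_nonneg fun k _ => h0 k ω) (abs_nonneg s))
  exact (Finset.sum_le_card_nsmul _ _ M fun k _ => h1 k ω).trans (by simp)

/-- The multiplicative Chernoff bound, upper tail. -/
theorem chernoff_upper (hind : iIndepFun Y μ) (hY : ∀ k, Measurable (Y k)) (hM : 0 < M)
    (h0 : ∀ k ω, 0 ≤ Y k ω) (h1 : ∀ k ω, Y k ω ≤ M) (hm : ∀ k, ∫ ω, Y k ω ∂μ = m) (N : ℕ)
    {e : ℝ} (he0 : 0 ≤ e) (he1 : e ≤ 1) :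
    μ.real {ω | N * ((1 + e) * m) ≤ ∑ k ∈ Finset.range N, Y k ω} ≤
      Real.exp (-(N * (e ^ 2 * m / (3 * M)))) := by
  have hm0 : 0 ≤ m := hm 0 ▸ integral_nonneg (h0 0)
  have h := measure_ge_le_exp_mul_mgf (μ := μ) (N * ((1 + e) * m)) (t := 2 / 3 * e / M)
    (by positivity) (integrable_exp_mul_sum hY h0 h1 N _)
  simp only [Finset.sum_apply] at h
  refine h.trans ((mul_le_mul_of_nonneg_left (mgf_sum_le hind hY hM h0 h1 hm N _)
    (Real.exp_pos _).le).trans ?_)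
  rw [← Real.exp_add, div_mul_cancel₀ _ hM.ne']
  refine Real.exp_le_exp.2 ?_
  have key := mul_le_mul_of_nonneg_left (exp_two_thirds_mul_le he0 he1)
    (show 0 ≤ N * (m / M) by positivity)
  refine le_trans (le_of_eq ?_) (key.trans (le_of_eq ?_))
  · field_simp
    ring
  · field_simp

/-- The multiplicative Chernoff bound, lower tail. -/
theorem chernoff_lower (hind : iIndepFun Y μ) (hY : ∀ k, Measurable (Y k)) (hM : 0 < M)
    (h0 : ∀ k ω, 0 ≤ Y k ω) (h1 : ∀ k ω, Y k ω ≤ M) (hm : ∀ k, ∫ ω, Y k ω ∂μ = m) (N : ℕ)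
    {d : ℝ} (hd : 0 ≤ d) :
    μ.real {ω | ∑ k ∈ Finset.range N, Y k ω ≤ N * ((1 - d) * m)} ≤
      Real.exp (-(N * (d ^ 2 * m / (2 * M)))) := by
  have hm0 : 0 ≤ m := hm 0 ▸ integral_nonneg (h0 0)
  have h := measure_le_le_exp_mul_mgf (μ := μ) (N * ((1 - d) * m)) (t := -d / M)
    (div_nonpos_of_nonpos_of_nonneg (by linarith) hM.le) (integrable_exp_mul_sum hY h0 h1 N _)
  simp only [Finset.sum_apply] at h
  refine h.trans ((mul_le_mul_of_nonneg_left (mgf_sum_le hind hY hM h0 h1 hm N _)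
    (Real.exp_pos _).le).trans ?_)
  rw [← Real.exp_add, div_mul_cancel₀ _ hM.ne']
  refine Real.exp_le_exp.2 ?_
  have key := mul_le_mul_of_nonneg_left (exp_neg_le hd) (show 0 ≤ N * (m / M) by positivity)
  refine le_trans (le_of_eq ?_) (key.trans (le_of_eq ?_))
  · field_simp
    ring
  · field_simp

end Chernoff

theorem theta_pos (t : ℕ) : 0 < theta t := Nat.two_pow_pos t

theorem theta_le_succ (t : ℕ) : theta t ≤ theta (t + 1) :=
  Nat.pow_le_pow_right two_pos t.le_succ

theorem one_le_theta (t : ℕ) : (1 : ℝ) ≤ theta t := by exact_mod_cast theta_pos t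

/-! ### Bounds on the sample size valid for every outcome -/

section SampleSize

variable {S : Type*} {i : S} {w : ℕ → ℕ → ℕ → S} {Δ ε α : ℝ}

theorem log_theta_pos (hα₀ : 0 < α) (hα₁ : α < 1) (t : ℕ) :
    0 < Real.log (4 * theta t / α) := by
  refine Real.log_pos ?_
  rw [lt_div_iff₀ hα₀]
  have := one_le_theta t
  linarith

theorem one_le_meanLength {N : ℕ} (hN : N ≠ 0) (t : ℕ) : 1 ≤ meanLength i w t N := by
  have hN' : (0 : ℝ) < N := Nat.cast_pos.2 (Nat.pos_of_ne_zero hN)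
  rw [meanLength, le_div_iff₀ hN', one_mul]
  refine le_trans (by simp) (Finset.card_nsmul_le_sum (Finset.range N)
    (fun k => (truncLength i (theta t) (w t k) : ℝ)) 1 fun k _ => ?_)
  exact_mod_cast one_le_truncLength (theta_pos t).ne' (w t k)

theorem meanLength_le {N : ℕ} (hN : N ≠ 0) (t : ℕ) : meanLength i w t N ≤ theta t := by
  have hN' : (0 : ℝ) < N := Nat.cast_pos.2 (Nat.pos_of_ne_zero hN)
  rw [meanLength, div_le_iff₀ hN', mul_comm]
  refine le_trans (Finset.sum_le_card_nsmul (Finset.range N)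
    (fun k => (truncLength i (theta t) (w t k) : ℝ)) (theta t) fun k _ => ?_) (by simp)
  exact_mod_cast truncLength_le (theta t) (w t k)

/-- Since T̂⁽ᵗ⁾ ≤ θ⁽ᵗ⁺¹⁾, the ratio in N⁽ᵗ⁺¹⁾ is at least 1. This bound needs no accuracy, and it is
what the estimate of the truncation probability relies on. -/
theorem le_numSamples (hε₀ : 0 < ε) (hα₀ : 0 < α) (hα₁ : α < 1) (t : ℕ) :
    3 * (1 + ε) * Real.log (4 * theta (t + 1) / α) / ε ^ 2 ≤ numSamples ε α i w (t + 1) := by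
  induction t with
  | zero =>
    refine le_trans ?_ (Nat.le_ceil _)
    have h := log_theta_pos hα₀ hα₁ 1
    have e : (4 * theta (0 + 1) / α : ℝ) = 8 / α := by norm_num [theta]
    have e' : (4 * theta 1 / α : ℝ) = 8 / α := by norm_num [theta]
    rw [e]
    rw [e'] at h
    gcongr
    norm_num
  | succ t ih =>
    have hlog := log_theta_pos hα₀ hα₁ (t + 1)
    have hlog' := log_theta_pos hα₀ hα₁ (t + 2)
    -- With no samples the mean would be the default 0, and division by it would give N = 0 again;
    -- hence the induction.
    have hN : numSamples ε α i w (t + 1) ≠ 0 := by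
      rintro h0
      rw [h0, Nat.cast_zero] at ih
      exact absurd ih (not_le.2 (by positivity))
    have h1 := one_le_meanLength (i := i) (w := w) hN (t + 1)
    have h2 := meanLength_le (i := i) (w := w) hN (t + 1)
    have h3 : (theta (t + 1) : ℝ) ≤ theta (t + 2) := by exact_mod_cast theta_le_succ (t + 1)
    refine le_trans ?_ (Nat.le_ceil _)
    rw [div_le_div_iff₀ (by positivity) (by positivity)]
    have : 0 ≤ 3 * (1 + ε) * Real.log (4 * theta (t + 2) / α) * ε ^ 2 := by positivity
    nlinarith [mul_le_mul_of_nonneg_left (h2.trans h3) this]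

theorem numSamples_ne_zero (hε₀ : 0 < ε) (hα₀ : 0 < α) (hα₁ : α < 1) (t : ℕ) :
    numSamples ε α i w (t + 1) ≠ 0 := by
  intro h0
  have h := le_numSamples (i := i) (w := w) hε₀ hα₀ hα₁ t
  have hlog := log_theta_pos hα₀ hα₁ (t + 1)
  rw [h0, Nat.cast_zero] at h
  exact absurd h (not_le.2 (by positivity))

theorem one_le_estReturn (hε₀ : 0 < ε) (hα₀ : 0 < α) (hα₁ : α < 1) (t : ℕ) :
    1 ≤ estReturn ε α i w (t + 1) :=
  one_le_meanLength (numSamples_ne_zero hε₀ hα₀ hα₁ t) (t + 1)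

theorem relError_eq (hε₀ : 0 < ε) (hα₀ : 0 < α) (hα₁ : α < 1) (π : S → ℝ) (t : ℕ) :
    relError ε α π i w (t + 1) = |1 - π i * estReturn ε α i w (t + 1)| := by
  have h := one_le_estReturn (i := i) (w := w) hε₀ hα₀ hα₁ t
  have h0 : estReturn ε α i w (t + 1) ≠ 0 := by linarith
  rw [relError, estProb]
  congr 1
  field_simp

end SampleSize

/-! ### What accurate samples imply, outcome by outcome -/

section Deterministic

variable {S : Type*} [Fintype S] [DecidableEq S] {P : Matrix S S ℝ} {π : S → ℝ} {i : S}
  {w : ℕ → ℕ → ℕ → S} {Δ ε α : ℝ}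

/-- The mean of the truncated return time in iteration `t`. -/
def truncMean (P : Matrix S S ℝ) (i : S) (t : ℕ) : ℝ :=
  ∑ n ∈ Finset.range (theta t), avoidProb P i n i

theorem one_le_truncMean (hP : P ∈ Matrix.rowStochastic ℝ S) (t : ℕ) : 1 ≤ truncMean P i t :=
  le_trans (by simp) (Finset.single_le_sum (f := fun n => avoidProb P i n i)
    (fun n _ => avoidProb_nonneg hP n i) (Finset.mem_range.2 (theta_pos t)))

theorem truncMean_le_succ (hP : P ∈ Matrix.rowStochastic ℝ S) (t : ℕ) :
    truncMean P i t ≤ truncMean P i (t + 1) :=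
  Finset.sum_le_sum_of_subset_of_nonneg (Finset.range_mono (theta_le_succ t))
    fun n _ _ => avoidProb_nonneg hP n i

/-- The estimate of the truncated mean return time in iteration `t` has relative error at most
`ε`. -/
def AccurateAt (P : Matrix S S ℝ) (ε α : ℝ) (i : S) (w : ℕ → ℕ → ℕ → S) (t : ℕ) : Prop :=
  |estReturn ε α i w t - truncMean P i t| ≤ ε * truncMean P i t

/-- The number of samples in iteration `t` suffices for a relative error `ε`. -/
def EnoughSamples (P : Matrix S S ℝ) (ε α : ℝ) (i : S) (t N : ℕ) : Prop :=
  3 * (theta t : ℝ) * Real.log (4 * theta t / α) / ε ^ 2 ≤ N * truncMean P i t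

theorem enoughSamples_one (hP : P ∈ Matrix.rowStochastic ℝ S) (hε₀ : 0 < ε) (hα₀ : 0 < α)
    (hα₁ : α < 1) : EnoughSamples P ε α i 1 (numSamples ε α i w 1) := by
  have hlog := log_theta_pos hα₀ hα₁ 1
  have hm := one_le_truncMean (i := i) hP 1
  have e : (4 * theta 1 / α : ℝ) = 8 / α := by norm_num [theta]
  rw [EnoughSamples]
  rw [e] at hlog ⊢
  calc 3 * (theta 1 : ℝ) * Real.log (8 / α) / ε ^ 2
      ≤ 6 * (1 + ε) * Real.log (8 / α) / ε ^ 2 := by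
        have h2 : (theta 1 : ℝ) = 2 := by norm_num [theta]
        rw [h2]
        refine div_le_div_of_nonneg_right ?_ (by positivity)
        nlinarith
    _ ≤ (numSamples ε α i w 1 : ℝ) := Nat.le_ceil _
    _ ≤ _ := le_mul_of_one_le_right (Nat.cast_nonneg _) hm

theorem AccurateAt.enoughSamples (hP : P ∈ Matrix.rowStochastic ℝ S) (hε₀ : 0 < ε) (hα₀ : 0 < α)
    (hα₁ : α < 1) {t : ℕ} (h : AccurateAt P ε α i w (t + 1)) :
    EnoughSamples P ε α i (t + 2) (numSamples ε α i w (t + 2)) := by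
  have hlog := log_theta_pos hα₀ hα₁ (t + 2)
  have hθ := one_le_theta (t + 2)
  have hm := one_le_truncMean (i := i) hP (t + 1)
  have hm' := truncMean_le_succ (i := i) hP (t + 1)
  have hT := one_le_estReturn (i := i) (w := w) hε₀ hα₀ hα₁ t
  -- Truncated means grow with t, so the overestimate of the old mean also bounds (1 + ε) times the
  -- new one. The factor 1 + ε in N⁽ᵗ⁺²⁾ absorbs it.
  have hT' : estReturn ε α i w (t + 1) ≤ (1 + ε) * truncMean P i (t + 2) := by
    have := (abs_le.1 h).2
    nlinarith
  have hN : 3 * (1 + ε) * (theta (t + 2) : ℝ) * Real.log (4 * (theta (t + 2) : ℝ) / α) /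
      (estReturn ε α i w (t + 1) * ε ^ 2) ≤ numSamples ε α i w (t + 2) := Nat.le_ceil _
  rw [EnoughSamples]
  refine le_trans ?_ (mul_le_mul_of_nonneg_right hN (by linarith))
  rw [div_mul_eq_mul_div, div_le_div_iff₀ (by positivity) (by positivity)]
  have : 0 ≤ 3 * (theta (t + 2) : ℝ) * Real.log (4 * theta (t + 2) / α) * ε ^ 2 := by positivity
  nlinarith [mul_le_mul_of_nonneg_left hT' this]

/-- With b = 1 - π_i m ≥ 0, accuracy confines 1 - π_i T̂ to the interval from (1+ε)b - ε to (1-ε)b +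
ε; the factor 1 - ε in front of the bias arises there. -/
theorem AccurateAt.relError_le (hP : P ∈ Matrix.rowStochastic ℝ S) (hirr : P.IsIrreducible)
    (hπ : IsStationaryDistribution P π) (hε₀ : 0 < ε) (hε₁ : ε < 1) (hα₀ : 0 < α)
    (hα₁ : α < 1) {t : ℕ} (h : AccurateAt P ε α i w (t + 1)) :
    relError ε α π i w (t + 1) ≤
      2 * (1 - ε) * avoidProb P i (theta (t + 1)) i * Zmax P π i + ε := by
  rw [relError_eq hε₀ hα₀ hα₁]
  have hlow : 0 ≤ 1 - π i * truncMean P i (t + 1) :=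
    sub_nonneg.2 (stationary_mul_sum_le_one hP hπ _)
  have hup : 1 - π i * truncMean P i (t + 1) ≤
      2 * avoidProb P i (theta (t + 1)) i * Zmax P π i :=
    one_sub_stationary_mul_sum_le hP hirr hπ (theta_pos (t + 1)).ne'
  obtain ⟨h1, h2⟩ := abs_le.1 h
  have h1' := mul_le_mul_of_nonneg_left h1 (hπ.nonneg i)
  have h2' := mul_le_mul_of_nonneg_left h2 (hπ.nonneg i)
  have hup' := mul_le_mul_of_nonneg_left hup (sub_nonneg.2 hε₁.le)
  have hpz : 0 ≤ (1 - ε) * (1 - π i * truncMean P i (t + 1)) :=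
    mul_nonneg (sub_nonneg.2 hε₁.le) hlow
  have hpz' := mul_nonneg hε₀.le hlow
  rw [abs_le]
  constructor <;> nlinarith

/-- The estimated truncation probability in iteration `t` is not much too small, if the true one is
large. -/
def TruncDetected (P : Matrix S S ℝ) (ε α : ℝ) (i : S) (w : ℕ → ℕ → ℕ → S) (t : ℕ) : Prop :=
  3 * ε < 2 * (1 - ε) * avoidProb P i (theta t) i →
    2 / 3 * avoidProb P i (theta t) i < truncFraction ε α i w t

theorem StopsAtB.relError_le (hP : P ∈ Matrix.rowStochastic ℝ S) (hirr : P.IsIrreducible)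
    (hπ : IsStationaryDistribution P π) (hε₀ : 0 < ε) (hε₁ : ε < 1) (hα₀ : 0 < α)
    (hα₁ : α < 1) {t : ℕ} (hs : StopsAtB Δ ε α i w (t + 1)) (h : AccurateAt P ε α i w (t + 1))
    (hd : TruncDetected P ε α i w (t + 1)) :
    relError ε α π i w (t + 1) ≤ ε * (3 * Zmax P π i + 1) := by
  obtain ⟨-, -, hA, hB⟩ := hs
  set p := avoidProb P i (theta (t + 1)) i with hp
  have hT := one_le_estReturn (i := i) (w := w) hε₀ hα₀ hα₁ t
  have hest : 0 < estProb ε α i w (t + 1) := one_div_pos.2 (by linarith)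
  rw [CondA, not_lt, div_le_iff₀ (by linarith)] at hA
  have hfrac : truncFraction ε α i w (t + 1) < ε * (1 + ε) := by
    refine lt_of_mul_lt_mul_right (lt_of_lt_of_le hB ?_) hest.le
    nlinarith
  have hple : 2 * (1 - ε) * p ≤ 3 * ε := by
    by_contra hcon
    -- Otherwise 2p/3 < p̂ < ε(1+ε), and multiplying by 3(1-ε) gives 2(1-ε)p ≤ 3ε(1-ε²) < 3ε.
    have h1 := hd (not_le.1 hcon)
    have h2 : 2 / 3 * p < ε * (1 + ε) := h1.trans hfrac
    have h3 := mul_le_mul_of_nonneg_left h2.le (sub_nonneg.2 hε₁.le)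
    nlinarith [pow_pos hε₀ 3]
  have := mul_le_mul_of_nonneg_right hple (Zmax_nonneg (P := P) (π := π) i)
  have := h.relError_le hP hirr hπ hε₀ hε₁ hα₀ hα₁
  linarith

end Deterministic

/-! ### Measurability and independence of the random sample sizes -/

section Measurability

variable {Ω : Type*} [MeasurableSpace Ω]

theorem measurable_random_index {β : Type*} [MeasurableSpace β] {N : Ω → ℕ} (hN : Measurable N)
    {F : ℕ → Ω → β} (hF : ∀ n, Measurable (F n)) : Measurable fun ω => F (N ω) ω :=
  (measurable_from_prod_countable_right (f := fun q : ℕ × Ω => F q.1 q.2) hF).comp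
    (hN.prodMk measurable_id)

variable {S : Type*} [MeasurableSpace S]

theorem iIndepFun_comp_row {μ : Measure Ω} {X : ℕ → ℕ → Ω → ℕ → S}
    (hindep : iIndepFun (fun p : ℕ × ℕ => X p.1 p.2) μ) (t : ℕ)
    {f : (ℕ → S) → ℝ} (hf : Measurable f) : iIndepFun (fun k ω => f (X t k ω)) μ :=
  (hindep.precomp (g := fun k : ℕ => (t, k)) fun _ _ h => (Prod.ext_iff.1 h).2).comp
    (fun _ => f) fun _ => hf

variable [MeasurableSingletonClass S] {X : ℕ → ℕ → Ω → ℕ → S} {i : S} {ε α : ℝ}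

theorem measurable_meanLength {t : ℕ} (hX : ∀ k, Measurable (X t k)) (n : ℕ) :
    Measurable fun ω => meanLength i (fun s k => X s k ω) t n := by
  unfold meanLength
  refine Measurable.div_const (Finset.measurable_fun_sum _ fun k _ => ?_) _
  exact measurable_from_nat.comp ((measurable_truncLength (theta t)).comp (hX k))

theorem measurable_numSamples (t : ℕ) (hX : ∀ s ≤ t, ∀ k, Measurable (X s k)) :
    Measurable fun ω => numSamples ε α i (fun s k => X s k ω) (t + 1) := by
  induction t with
  | zero => exact measurable_const
  | succ t ih =>
    have h := measurable_random_index (ih fun s hs => hX s (hs.trans t.le_succ))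
      (measurable_meanLength (i := i) (hX (t + 1) le_rfl))
    exact Nat.measurable_ceil.comp ((h.mul_const (ε ^ 2)).const_div _)

end Measurability

section RandomIndex

variable {Ω : Type*} {m₁ m₂ mΩ : MeasurableSpace Ω} {μ : Measure Ω} [IsProbabilityMeasure μ]

/-- A bound for events that holds for each fixed sample size holds for a random sample size that is
independent of the events. -/
theorem measure_random_index_le (hind : Indep m₁ m₂ μ) (h₁ : m₁ ≤ mΩ) {N : Ω → ℕ}
    (hN : Measurable[m₁] N) {G : Set ℕ} {B : ℕ → Set Ω} (hB : ∀ n, MeasurableSet[m₂] (B n))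
    {c : ℝ≥0∞} (hc : ∀ n ∈ G, μ (B n) ≤ c) : μ {ω | N ω ∈ G ∧ ω ∈ B (N ω)} ≤ c := by
  have hsub : {ω | N ω ∈ G ∧ ω ∈ B (N ω)} ⊆ ⋃ n, ⋃ _ : n ∈ G, N ⁻¹' {n} ∩ B n := fun ω hω =>
    Set.mem_iUnion.2 ⟨N ω, Set.mem_iUnion.2 ⟨hω.1, rfl, hω.2⟩⟩
  have hterm : ∀ n, μ (⋃ _ : n ∈ G, N ⁻¹' {n} ∩ B n) ≤ μ (N ⁻¹' {n}) * c := fun n => by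
    by_cases hn : n ∈ G
    · simp only [hn, Set.iUnion_true]
      rw [(Indep_iff m₁ m₂ μ).1 hind _ _ (hN (measurableSet_singleton n)) (hB n)]
      exact mul_le_mul_right (hc n hn) _
    · simp [hn]
  have hdisj : ∑' n, μ (N ⁻¹' {n}) ≤ 1 := by
    rw [← measure_iUnion (fun a b hab => Set.disjoint_left.2 fun ω ha hb => hab (ha.symm.trans hb))
      fun n => h₁ _ (hN (measurableSet_singleton n))]
    exact prob_le_one
  calc μ {ω | N ω ∈ G ∧ ω ∈ B (N ω)} ≤ ∑' n, μ (⋃ _ : n ∈ G, N ⁻¹' {n} ∩ B n) :=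
        (measure_mono hsub).trans (measure_iUnion_le _)
    _ ≤ ∑' n, μ (N ⁻¹' {n}) * c := ENNReal.tsum_le_tsum hterm
    _ ≤ c := by
        rw [ENNReal.tsum_mul_right]
        exact mul_le_of_le_one_left' hdisj

end RandomIndex

section RandomSampleSize

variable {S : Type*} [MeasurableSpace S] [MeasurableSingletonClass S] {i : S} {ε α : ℝ}
  {Ω : Type*} [mΩ : MeasurableSpace Ω] {μ : Measure Ω} [IsProbabilityMeasure μ]
  {X : ℕ → ℕ → Ω → ℕ → S}

/-- An event that depends on the samples of iteration `t + 1` and on their number has probability at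
most `c` if it has for each of the sample sizes that may occur. -/
theorem measure_numSamples_le (hX : ∀ t k, Measurable (X t k))
    (hindep : iIndepFun (fun p : ℕ × ℕ => X p.1 p.2) μ) (t : ℕ) {G : Set ℕ} {B : ℕ → Set Ω}
    (hB : ∀ (m : MeasurableSpace Ω), (∀ k, Measurable[m] (X (t + 1) k)) →
      ∀ n, MeasurableSet[m] (B n))
    {c : ℝ≥0∞} (hc : ∀ n ∈ G, μ (B n) ≤ c) :
    μ {ω | numSamples ε α i (fun s k => X s k ω) (t + 1) ∈ G ∧
      ω ∈ B (numSamples ε α i (fun s k => X s k ω) (t + 1))} ≤ c := by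
  -- Iterations up to t determine N⁽ᵗ⁺¹⁾. Since `hB` holds for every σ-algebra making the samples of
  -- iteration t + 1 measurable, it applies to the one they generate, which is independent of the
  -- past.
  let σ : Set (ℕ × ℕ) → MeasurableSpace Ω := fun T =>
    ⨆ p ∈ T, MeasurableSpace.comap (X p.1 p.2) inferInstance
  have hσ : ∀ T : Set (ℕ × ℕ), ∀ p ∈ T, Measurable[σ T] (X p.1 p.2) := fun T p hp =>
    (comap_measurable _).mono
      (le_iSup₂ (f := fun (p : ℕ × ℕ) (_ : p ∈ T) =>
        MeasurableSpace.comap (X p.1 p.2) inferInstance) p hp) le_rfl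
  have hle : ∀ p : ℕ × ℕ, MeasurableSpace.comap (X p.1 p.2) inferInstance ≤ mΩ := fun p =>
    (hX p.1 p.2).comap_le
  have hind : Indep (σ {p | p.1 ≤ t}) (σ {p | p.1 = t + 1}) μ := by
    refine indep_iSup_of_disjoint hle ((iIndepFun_iff_iIndep _ _ _).1 hindep) ?_
    refine Set.disjoint_left.2 fun p (hp : p.1 ≤ t) (hp' : p.1 = t + 1) => ?_
    omega
  refine measure_random_index_le hind (iSup₂_le fun p _ => hle p) ?_ (hB _ fun k => ?_) hc
  · exact @measurable_numSamples Ω (σ {p | p.1 ≤ t}) S _ _ X i ε α t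
      fun s hs k => hσ {p | p.1 ≤ t} (s, k) hs
  · exact hσ {p | p.1 = t + 1} (t + 1, k) rfl

end RandomSampleSize

/-! ### Failure probabilities and the union bound over iterations -/

section Concentration

variable {S : Type*} [Fintype S] [DecidableEq S] [MeasurableSpace S] [MeasurableSingletonClass S]
  {P : Matrix S S ℝ} {π : S → ℝ} {i : S} {Δ ε α : ℝ}
  {Ω : Type*} [mΩ : MeasurableSpace Ω] {μ : Measure Ω} [IsProbabilityMeasure μ]
  {X : ℕ → ℕ → Ω → ℕ → S}

theorem exp_neg_log_le {x y : ℝ} (hx : 0 < x) (h : Real.log x ≤ y) : Real.exp (-y) ≤ 1 / x := by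
  rw [one_div, ← Real.exp_log (inv_pos.2 hx), Real.log_inv]
  exact Real.exp_le_exp.2 (neg_le_neg h)

theorem measure_not_accurate_le (hP : P ∈ Matrix.rowStochastic ℝ S)
    (hX : ∀ t k, Measurable (X t k)) (hlaw : ∀ t k, HasLaw (X t k) (pathLaw P hP i) μ)
    (hindep : iIndepFun (fun p : ℕ × ℕ => X p.1 p.2) μ)
    (hε₀ : 0 < ε) (hε₁ : ε < 1) (hα₀ : 0 < α) (hα₁ : α < 1) (t : ℕ) {n : ℕ}
    (hn : EnoughSamples P ε α i t n) :
    μ {ω | ¬ |meanLength i (fun s k => X s k ω) t n - truncMean P i t| ≤ ε * truncMean P i t} ≤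
      ENNReal.ofReal (α / (2 * theta t)) := by
  have hθ : (0 : ℝ) < theta t := Nat.cast_pos.2 (theta_pos t)
  have hm := one_le_truncMean (i := i) hP t
  have hlog := log_theta_pos hα₀ hα₁ t
  have hfm : Measurable fun x : ℕ → S => (truncLength i (theta t) x : ℝ) :=
    measurable_from_nat.comp (measurable_truncLength (theta t))
  have hind := iIndepFun_comp_row hindep t hfm
  have hmeas : ∀ k, Measurable fun ω => (truncLength i (theta t) (X t k ω) : ℝ) := fun k =>
    hfm.comp (hX t k)
  have hmean : ∀ k, ∫ ω, (truncLength i (theta t) (X t k ω) : ℝ) ∂μ = truncMean P i t := fun k => by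
    rw [truncMean, ← integral_truncLength hP, ← (hlaw t k).map_eq,
      integral_map (hX t k).aemeasurable hfm.aestronglyMeasurable]
  have h0 : ∀ (k : ℕ) (ω : Ω), (0 : ℝ) ≤ truncLength i (theta t) (X t k ω) := fun _ _ =>
    Nat.cast_nonneg _
  have h1 : ∀ (k : ℕ) (ω : Ω), (truncLength i (theta t) (X t k ω) : ℝ) ≤ theta t := fun k ω =>
    Nat.cast_le.2 (truncLength_le _ _)
  have hn0 : (0 : ℝ) < n := by
    by_contra hcon
    have hz : (n : ℝ) = 0 := le_antisymm (not_lt.1 hcon) (Nat.cast_nonneg n)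
    rw [EnoughSamples, hz, zero_mul] at hn
    exact absurd hn (not_le.2 (by positivity))
  -- The logarithm of 4θ/α makes each of the two tails at most α/(4θ).
  have hexp : Real.log (4 * theta t / α) ≤ n * (ε ^ 2 * truncMean P i t / (3 * theta t)) := by
    rw [EnoughSamples, div_le_iff₀ (by positivity)] at hn
    rw [← mul_div_assoc, le_div_iff₀ (by positivity)]
    linarith
  have hexp' : Real.log (4 * theta t / α) ≤ n * (ε ^ 2 * truncMean P i t / (2 * theta t)) := by
    refine hexp.trans ?_
    gcongr
    norm_num
  have hup := (chernoff_upper hind hmeas hθ h0 h1 hmean n hε₀.le hε₁.le).trans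
    (exp_neg_log_le (by positivity) hexp)
  have hlow := (chernoff_lower hind hmeas hθ h0 h1 hmean n hε₀.le).trans
    (exp_neg_log_le (by positivity) hexp')
  rw [← ENNReal.ofReal_toReal (measure_ne_top μ _)]
  refine ENNReal.ofReal_le_ofReal ?_
  refine (measureReal_mono (fun ω hω => ?_) (measure_ne_top _ _)).trans
    ((measureReal_union_le _ _).trans ((add_le_add hup hlow).trans_eq ?_))
  · by_contra hcon
    rw [Set.mem_union, not_or] at hcon
    refine hω ?_
    have h2 : ∑ k ∈ Finset.range n, (truncLength i (theta t) (X t k ω) : ℝ) <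
        n * ((1 + ε) * truncMean P i t) := not_le.1 hcon.1
    have h3 : n * ((1 - ε) * truncMean P i t) <
        ∑ k ∈ Finset.range n, (truncLength i (theta t) (X t k ω) : ℝ) := not_le.1 hcon.2
    rw [← div_lt_iff₀' hn0] at h2
    rw [← lt_div_iff₀' hn0] at h3
    rw [abs_le]
    unfold meanLength
    constructor <;> linarith
  · field_simp
    norm_num

open Classical in
theorem measure_not_detected_le (hP : P ∈ Matrix.rowStochastic ℝ S)
    (hX : ∀ t k, Measurable (X t k)) (hlaw : ∀ t k, HasLaw (X t k) (pathLaw P hP i) μ)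
    (hindep : iIndepFun (fun p : ℕ × ℕ => X p.1 p.2) μ)
    (hε₀ : 0 < ε) (hα₀ : 0 < α) (hα₁ : α < 1) (t : ℕ) {n : ℕ}
    (hn : 3 * (1 + ε) * Real.log (4 * theta t / α) / ε ^ 2 ≤ n)
    (hp : 3 * ε < 2 * (1 - ε) * avoidProb P i (theta t) i) :
    μ {ω | ((Finset.range n).filter fun k => (theta t : ℕ∞) < returnTime i (X t k ω)).card / (n : ℝ)
        ≤ 2 / 3 * avoidProb P i (theta t) i} ≤
      ENNReal.ofReal (α / (4 * theta t)) := by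
  have hθ : (0 : ℝ) < theta t := Nat.cast_pos.2 (theta_pos t)
  have hlog := log_theta_pos hα₀ hα₁ t
  set p := avoidProb P i (theta t) i with hpdef
  set E := {x : ℕ → S | (theta t : ℕ∞) < returnTime i x} with hE
  have hEm : MeasurableSet E := measurableSet_lt_returnTime (theta t)
  have hfm : Measurable (E.indicator fun _ => (1 : ℝ)) := measurable_const.indicator hEm
  have hind := iIndepFun_comp_row hindep t hfm
  have hmeas : ∀ k, Measurable fun ω => E.indicator (fun _ => (1 : ℝ)) (X t k ω) := fun k =>
    hfm.comp (hX t k)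
  have hmean : ∀ k, ∫ ω, E.indicator (fun _ => (1 : ℝ)) (X t k ω) ∂μ = p := fun k => by
    rw [← integral_map (f := E.indicator fun _ => (1 : ℝ)) (hX t k).aemeasurable
      hfm.aestronglyMeasurable, (hlaw t k).map_eq,
      integral_indicator_const _ hEm, smul_eq_mul, mul_one, hpdef, ← returnTail_eq hP]
    rfl
  have h0 : ∀ (k : ℕ) (ω : Ω), 0 ≤ E.indicator (fun _ => (1 : ℝ)) (X t k ω) := fun _ _ =>
    Set.indicator_nonneg (fun _ _ => zero_le_one) _
  have h1 : ∀ (k : ℕ) (ω : Ω), E.indicator (fun _ => (1 : ℝ)) (X t k ω) ≤ 1 := fun _ _ =>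
    Set.indicator_le_self' (fun _ _ => zero_le_one) _
  have hn0 : (0 : ℝ) < n := lt_of_lt_of_le (by positivity) hn
  have hp0 : 0 ≤ p := avoidProb_nonneg hP _ _
  -- Bounding p below by 3ε/(2(1-ε)) reduces this to 4ε(1-ε) ≤ 1 + ε. It turns the accuracy-free
  -- sample bound into np ≥ 18 log(4θ/α).
  have hp6 : 6 * ε ^ 2 ≤ (1 + ε) * p := by
    have : ε < 1 := by
      by_contra hcon
      nlinarith [mul_nonneg (sub_nonneg.2 (not_lt.1 hcon)) hp0]
    have h2 : 4 * (1 - ε) * ε ^ 2 ≤ (1 + ε) * ε := by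
      nlinarith [mul_nonneg hε₀.le (sq_nonneg (2 * ε - 1)), pow_pos hε₀ 2]
    refine le_of_mul_le_mul_left ?_ (show 0 < 2 * (1 - ε) by linarith)
    nlinarith
  have hexp : Real.log (4 * theta t / α) ≤ n * ((1 / 3 : ℝ) ^ 2 * p / (2 * 1)) := by
    rw [div_le_iff₀ (by positivity)] at hn
    have h2 := mul_le_mul_of_nonneg_left hp6 hn0.le
    have h3 : 18 * (1 + ε) * Real.log (4 * theta t / α) ≤ (1 + ε) * (n * p) := by linarith
    have h4 : 18 * Real.log (4 * theta t / α) ≤ n * p :=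
      le_of_mul_le_mul_left (by linarith) (show 0 < 1 + ε by linarith)
    linarith
  -- The deviation 1/3 matches the fraction 2/3, and its exponent np/18 matches the 18 above.
  have hlow := (chernoff_lower hind hmeas one_pos h0 h1 hmean n (d := 1 / 3) (by norm_num)).trans
    (exp_neg_log_le (by positivity) hexp)
  rw [← ENNReal.ofReal_toReal (measure_ne_top μ _)]
  refine ENNReal.ofReal_le_ofReal ?_
  refine (measureReal_mono (fun ω hω => ?_) (measure_ne_top _ _)).trans (hlow.trans_eq ?_)
  · have hω' : ((Finset.range n).filter fun k =>
      (theta t : ℕ∞) < returnTime i (X t k ω)).card / (n : ℝ) ≤ 2 / 3 * p := hω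
    rw [div_le_iff₀ hn0] at hω'
    have hsum : ∑ k ∈ Finset.range n, E.indicator (fun _ => (1 : ℝ)) (X t k ω) =
        ((Finset.range n).filter fun k => (theta t : ℕ∞) < returnTime i (X t k ω)).card := by
      simp [Set.indicator_apply, hE]
    change ∑ k ∈ Finset.range n, E.indicator (fun _ => (1 : ℝ)) (X t k ω) ≤ _
    rw [hsum]
    linarith
  · rw [one_div_div]

/-- Doubling truncation lengths makes the union bound free: ∑_{t≥1} 2⁻ᵗ = 1. -/
theorem tsum_ofReal_div_theta {c : ℝ} (hc : 0 ≤ c) :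
    ∑' t, ENNReal.ofReal (c / theta (t + 1)) = ENNReal.ofReal c := by
  have e : ∀ t, c / (theta (t + 1) : ℝ) = c / 2 / 2 ^ t := fun t => by
    rw [theta]
    push_cast
    rw [pow_succ']
    field_simp
  have h := hasSum_geometric_two' c
  simp only [e]
  rw [← ENNReal.ofReal_tsum_of_nonneg (fun t => by positivity) h.summable, h.tsum_eq]

theorem measure_compl_accurate_le (hP : P ∈ Matrix.rowStochastic ℝ S)
    (hX : ∀ t k, Measurable (X t k)) (hlaw : ∀ t k, HasLaw (X t k) (pathLaw P hP i) μ)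
    (hindep : iIndepFun (fun p : ℕ × ℕ => X p.1 p.2) μ)
    (hε₀ : 0 < ε) (hε₁ : ε < 1) (hα₀ : 0 < α) (hα₁ : α < 1) :
    μ {ω | ∀ t, AccurateAt P ε α i (fun s k => X s k ω) (t + 1)}ᶜ ≤ ENNReal.ofReal (α / 2) := by
  let B : ℕ → ℕ → Set Ω := fun t n =>
    {ω | ¬ |meanLength i (fun s k => X s k ω) t n - truncMean P i t| ≤ ε * truncMean P i t}
  let D : ℕ → Set Ω := fun t =>
    {ω | numSamples ε α i (fun s k => X s k ω) (t + 1) ∈ {n | EnoughSamples P ε α i (t + 1) n} ∧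
      ω ∈ B (t + 1) (numSamples ε α i (fun s k => X s k ω) (t + 1))}
  have hsub : {ω | ∀ t, AccurateAt P ε α i (fun s k => X s k ω) (t + 1)}ᶜ ⊆ ⋃ t, D t := by
    intro ω hω
    by_contra hD
    simp only [Set.mem_iUnion, not_exists] at hD
    -- D t is failure despite a sufficient sample. Outside all D t, sufficiency and accuracy imply
    -- each other forward in t, so no conditioning on past accuracy is needed.
    have step : ∀ t, EnoughSamples P ε α i (t + 1) (numSamples ε α i (fun s k => X s k ω) (t + 1)) →
        AccurateAt P ε α i (fun s k => X s k ω) (t + 1) := fun t he => by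
      by_contra hcon
      exact hD t ⟨he, hcon⟩
    refine hω fun t => ?_
    induction t with
    | zero => exact step 0 (enoughSamples_one hP hε₀ hα₀ hα₁)
    | succ t ih => exact step (t + 1) (ih.enoughSamples hP hε₀ hα₀ hα₁)
  have hD : ∀ t, μ (D t) ≤ ENNReal.ofReal (α / 2 / theta (t + 1)) := fun t => by
    refine measure_numSamples_le hX hindep t (fun m hm n => ?_) fun n hn => ?_
    · have := measurable_meanLength (i := i) hm n
      have hset : MeasurableSet {r : ℝ | |r - truncMean P i (t + 1)| ≤ ε * truncMean P i (t + 1)} :=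
        measurableSet_le (by fun_prop) (by fun_prop)
      exact this hset.compl
    · rw [div_div]
      exact measure_not_accurate_le hP hX hlaw hindep hε₀ hε₁ hα₀ hα₁ (t + 1) hn
  calc _ ≤ ∑' t, μ (D t) := (measure_mono hsub).trans (measure_iUnion_le _)
    _ ≤ _ := ENNReal.tsum_le_tsum hD
    _ = _ := tsum_ofReal_div_theta (by positivity)

theorem measure_compl_detected_le (hP : P ∈ Matrix.rowStochastic ℝ S)
    (hX : ∀ t k, Measurable (X t k)) (hlaw : ∀ t k, HasLaw (X t k) (pathLaw P hP i) μ)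
    (hindep : iIndepFun (fun p : ℕ × ℕ => X p.1 p.2) μ)
    (hε₀ : 0 < ε) (hα₀ : 0 < α) (hα₁ : α < 1) :
    μ {ω | ∀ t, TruncDetected P ε α i (fun s k => X s k ω) (t + 1)}ᶜ ≤
      ENNReal.ofReal (α / 4) := by
  classical
  let B : ℕ → ℕ → Set Ω := fun t n =>
    {ω | 3 * ε < 2 * (1 - ε) * avoidProb P i (theta t) i ∧
      ((Finset.range n).filter fun k => (theta t : ℕ∞) < returnTime i (X t k ω)).card / (n : ℝ)
        ≤ 2 / 3 * avoidProb P i (theta t) i}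
  let G : ℕ → Set ℕ := fun t => {n | 3 * (1 + ε) * Real.log (4 * theta t / α) / ε ^ 2 ≤ n}
  let D : ℕ → Set Ω := fun t =>
    {ω | numSamples ε α i (fun s k => X s k ω) (t + 1) ∈ G (t + 1) ∧
      ω ∈ B (t + 1) (numSamples ε α i (fun s k => X s k ω) (t + 1))}
  have hsub : {ω | ∀ t, TruncDetected P ε α i (fun s k => X s k ω) (t + 1)}ᶜ ⊆ ⋃ t, D t := by
    intro ω hω
    by_contra hD
    simp only [Set.mem_iUnion, not_exists] at hD
    refine hω fun t hp => ?_
    by_contra hcon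
    refine hD t ⟨le_numSamples hε₀ hα₀ hα₁ t, hp, ?_⟩
    rw [truncFraction, not_lt] at hcon
    convert hcon
  have hD : ∀ t, μ (D t) ≤ ENNReal.ofReal (α / 4 / theta (t + 1)) := fun t => by
    by_cases hp : 3 * ε < 2 * (1 - ε) * avoidProb P i (theta (t + 1)) i
    · refine measure_numSamples_le hX hindep t (fun m hm n => ?_) fun n hn => ?_
      · have : ∀ ω, (((Finset.range n).filter
            fun k => (theta (t + 1) : ℕ∞) < returnTime i (X (t + 1) k ω)).card : ℝ) =
            ∑ k ∈ Finset.range n, if (theta (t + 1) : ℕ∞) < returnTime i (X (t + 1) k ω)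
              then (1 : ℝ) else 0 := fun ω => by simp
        simp only [B, hp, true_and, this]
        refine measurableSet_le (Measurable.div_const (Finset.measurable_fun_sum _ fun k _ => ?_) _)
          measurable_const
        exact Measurable.ite ((hm k) (measurableSet_lt_returnTime (theta (t + 1))))
          measurable_const measurable_const
      · rw [div_div]
        refine (measure_mono fun ω hω => hω.2).trans
          (measure_not_detected_le hP hX hlaw hindep hε₀ hα₀ hα₁ (t + 1) hn hp)
    · have : D t = ∅ := by
        ext ω
        simp [D, B, hp]
      simp [this]
  calc _ ≤ ∑' t, μ (D t) := (measure_mono hsub).trans (measure_iUnion_le _)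
    _ ≤ _ := ENNReal.tsum_le_tsum hD
    _ = _ := tsum_ofReal_div_theta (by positivity)

/-- The concentration bounds for samples that are only almost everywhere measurable. -/
theorem measure_compl_accurate_detected_le (hP : P ∈ Matrix.rowStochastic ℝ S)
    (hlaw : ∀ t k, HasLaw (X t k) (pathLaw P hP i) μ)
    (hindep : iIndepFun (fun p : ℕ × ℕ => X p.1 p.2) μ)
    (hε₀ : 0 < ε) (hε₁ : ε < 1) (hα₀ : 0 < α) (hα₁ : α < 1) :
    μ {ω | ∀ t, AccurateAt P ε α i (fun s k => X s k ω) (t + 1) ∧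
      TruncDetected P ε α i (fun s k => X s k ω) (t + 1)}ᶜ ≤ ENNReal.ofReal (3 * α / 4) := by
  let X' : ℕ → ℕ → Ω → ℕ → S := fun t k => (hlaw t k).aemeasurable.mk (X t k)
  have hX' : ∀ t k, Measurable (X' t k) := fun t k => (hlaw t k).aemeasurable.measurable_mk
  have hae : ∀ t k, X t k =ᵐ[μ] X' t k := fun t k => (hlaw t k).aemeasurable.ae_eq_mk
  have hlaw' : ∀ t k, HasLaw (X' t k) (pathLaw P hP i) μ := fun t k =>
    (hlaw t k).congr (hae t k).symm
  have hindep' : iIndepFun (fun p : ℕ × ℕ => X' p.1 p.2) μ :=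
    hindep.congr fun p => hae p.1 p.2
  -- There are countably many samples, so all agree with their measurable versions off a single null
  -- set.
  have hall : ∀ᵐ ω ∂μ, (fun s k => X s k ω) = fun s k => X' s k ω := by
    have : ∀ᵐ ω ∂μ, ∀ s k, X s k ω = X' s k ω := ae_all_iff.2 fun s => ae_all_iff.2 fun k => hae s k
    filter_upwards [this] with ω hω
    exact funext fun s => funext fun k => hω s k
  have hle : μ {ω | ∀ t, AccurateAt P ε α i (fun s k => X s k ω) (t + 1) ∧
      TruncDetected P ε α i (fun s k => X s k ω) (t + 1)}ᶜ ≤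
      μ ({ω | ∀ t, AccurateAt P ε α i (fun s k => X' s k ω) (t + 1)}ᶜ ∪
        {ω | ∀ t, TruncDetected P ε α i (fun s k => X' s k ω) (t + 1)}ᶜ) := by
    refine measure_mono_ae ?_
    filter_upwards [hall] with ω hω hbad
    by_contra hcon
    have hcon' := not_or.1 hcon
    refine hbad fun t => ?_
    rw [hω]
    exact ⟨Set.notMem_compl_iff.1 hcon'.1 t, Set.notMem_compl_iff.1 hcon'.2 t⟩
  refine hle.trans ((measure_union_le _ _).trans
    ((add_le_add (measure_compl_accurate_le hP hX' hlaw' hindep' hε₀ hε₁ hα₀ hα₁)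
      (measure_compl_detected_le hP hX' hlaw' hindep' hε₀ hα₀ hα₁)).trans_eq ?_))
  rw [← ENNReal.ofReal_add (by positivity) (by positivity)]
  congr 1
  ring

/-- The slack 3α/4 < α gives strictness. Only subadditivity is used, so neither event has to be
measurable. -/
theorem lt_measureReal_of_compl_le {A B : Set Ω} (hα₀ : 0 < α)
    (hA : μ Aᶜ ≤ ENNReal.ofReal (3 * α / 4)) (hAB : A ⊆ B) : 1 - α < μ.real B := by
  have h1 : μ.real Aᶜ ≤ 3 * α / 4 :=
    ENNReal.toReal_le_of_le_ofReal (by positivity) hA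
  have h2 : μ.real (Set.univ : Set Ω) ≤ μ.real A + μ.real Aᶜ := by
    rw [← Set.union_compl_self A]
    exact measureReal_union_le _ _
  have h3 : μ.real A ≤ μ.real B := measureReal_mono hAB (measure_ne_top _ _)
  rw [probReal_univ] at h2
  linarith

end Concentration

end TruncatedWalk

open TruncatedWalk
theorem mainTheorem3 {S : Type*} [Fintype S] [DecidableEq S]
    [MeasurableSpace S] [MeasurableSingletonClass S]
    (P : Matrix S S ℝ) (hP : P ∈ Matrix.rowStochastic ℝ S) (hirr : P.IsIrreducible)
    (π : S → ℝ) (hπ : IsStationaryDistribution P π) (i : S)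
    (Δ ε α : ℝ) (hΔ₀ : 0 < Δ) (hΔ₁ : Δ < 1) (hε₀ : 0 < ε) (hε₁ : ε < 1) (hα₀ : 0 < α) (hα₁ : α < 1)
    {Ω : Type*} [MeasurableSpace Ω] (μ : Measure Ω) [IsProbabilityMeasure μ]
    (X : ℕ → ℕ → Ω → ℕ → S)
    (hlaw : ∀ t k, HasLaw (X t k) (pathLaw P hP i) μ)
    (hindep : iIndepFun (fun p : ℕ × ℕ => X p.1 p.2) μ) :
    1 - α < μ.real {ω | ∀ t, 1 ≤ t →
        relError ε α π i (fun s k => X s k ω) t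
            ≤ 2 * (1 - ε) * returnTail P hP i (theta t) * Zmax P π i + ε ∧
        2 * (1 - ε) * returnTail P hP i (theta t) * Zmax P π i + ε
            ≤ 4 * (1 - ε) * (2 : ℝ) ^ (-((theta t : ℝ) / (2 * maxHitting P hP i))) * Zmax P π i
              + ε} ∧
    1 - α < μ.real {ω | ∀ t, StopsAtB Δ ε α i (fun s k => X s k ω) t →
        relError ε α π i (fun s k => X s k ω) t ≤ ε * (3 * Zmax P π i + 1)} := by
  have hgood := measure_compl_accurate_detected_le hP hlaw hindep hε₀ hε₁ hα₀ hα₁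
  constructor
  · refine lt_measureReal_of_compl_le hα₀ hgood fun ω hω t ht => ⟨?_, ?_⟩
    · obtain ⟨t, rfl⟩ := Nat.exists_eq_add_of_le' ht
      rw [returnTail_eq]
      exact (hω t).1.relError_le hP hirr hπ hε₀ hε₁ hα₀ hα₁
    -- The second inequality involves no samples; it is the tail bound multiplied by 2(1-ε) Z_max ≥
    -- 0.
    · have h1 := mul_le_mul_of_nonneg_left (returnTail_le (i := i) hP hirr hπ (theta t))
        (mul_nonneg zero_le_two (sub_nonneg.2 hε₁.le))
      have h2 := mul_le_mul_of_nonneg_right h1 (Zmax_nonneg (P := P) (π := π) i)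
      linarith
  · refine lt_measureReal_of_compl_le hα₀ hgood fun ω hω t ht => ?_
    obtain ⟨t, rfl⟩ := Nat.exists_eq_add_of_le' ht.1
    exact ht.relError_le hP hirr hπ hε₀ hε₁ hα₀ hα₁ (hω t).1 (hω t).2
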